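/- Let $k$ be a perfect field. For finite-dimensional $k[x]$-modules $V,W$ let $V\otimes W$ be the vector space $V\otimes_k W$ on which $x$ acts by $v\otimes w\mapsto xv\otimes xw$ (the tensor product coming from the comultiplication $x\mapsto x\otimes x$). Let $R$ be the representation ring of $k[x]$: the abelian group generated by the isomorphism classes $[V]$ of finite-dimensional $k[x]$-modules, subject to the relations $[V\oplus W]=[V]+[W]$, with product $[V][W]=[V\otimes W]$. It is a commutative ring, and $\dim:R\to\mathbb Z$, $\dim[V]=\dim_k V$, is a ring homomorphism. Let $R'\subseteq R$ be the $\mathbb Z$-span of all $[k[x]/(x-1)^s]$ with $s\ge 1$, let $\bar R\subseteq R$ be the $\mathbb Z$-span of all $[k[x]/(f)]$ with $f\in k[x]$ irreducible and $f(0)\ne 0$, and let $I\subseteq R$ be the $\mathbb Z$-span of all $[k[x]/(x^s)]$ with $s\ge 1$. Then $R$ is freely generated, as an abelian group, by the isomorphism classes of indecomposable finite-dimensional $k[x]$-modules. Moreover $R'$ and $\bar R$ are subrings of $R$, $I$ is an ideal of $R$, and, if the abelian group $R'\otimes_{\mathbb Z}\bar R\oplus I$ is made into a ring by using the given multiplications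 of $R'\otimes_{\mathbb Z}\bar R$ and of $I$ together with $$(a\otimes b)\,w=w\,(a\otimes b)=\dim(a)\dim(b)\,w\qquad(a\in R',\ b\in\bar R,\ w\in I),$$ then the $\mathbb Z$-linear map $$\phi: R'\otimes_{\mathbb Z}\bar R\oplus I\to R,\qquad \phi(a\otimes b+w)=ab+w,$$ is a ring isomorphism. -/

import Mathlib

open scoped TensorProduct Polynomial

universe u

noncomputable section

namespace PolyRep

/-- A finite-dimensional (left) module over `k[x]`: a `k[x]`-module, with its underlying
`k`-vector space structure, which is finite-dimensional over `k`. -/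
structure FDMod (k : Type u) [Field k] where
  /-- the underlying set -/
  carrier : Type u
  [addCommGroup : AddCommGroup carrier]
  [module : Module k carrier]
  [polyModule : Module k[X] carrier]
  [isScalarTower : IsScalarTower k k[X] carrier]
  [finite : Module.Finite k carrier]

attribute [instance] FDMod.addCommGroup FDMod.module FDMod.polyModule FDMod.isScalarTower
  FDMod.finite

section

variable {k : Type u} [Field k]

/-- The linear operator `v ↦ x v` on a `k[x]`-module. -/
def xOp (V : Type u) [AddCommGroup V] [Module k V] [Module k[X] V] [IsScalarTower k k[X] V] :
    V →ₗ[k] V :=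
  Algebra.lsmul k k V (Polynomial.X : k[X])

@[simp]
theorem xOp_apply {V : Type u} [AddCommGroup V] [Module k V] [Module k[X] V]
    [IsScalarTower k k[X] V] (v : V) : xOp (k := k) V v = (Polynomial.X : k[X]) • v :=
  rfl

/-- The `k[x]`-module given by a linear operator on a finite-dimensional vector space:
`x` acts as the operator. -/
def FDMod.ofOp {V : Type u} [AddCommGroup V] [Module k V] [Module.Finite k V]
    (a : Module.End k V) : FDMod k where
  carrier := Module.AEval' a

/-- The tensor product `V ⊗ W` of `k[x]`-modules along the comultiplication `x ↦ x ⊗ x`: the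
vector space `V ⊗ₖ W`, on which `x` acts by `v ⊗ w ↦ x v ⊗ x w`. -/
def FDMod.tensor (V W : FDMod k) : FDMod k :=
  FDMod.ofOp (TensorProduct.map (xOp (k := k) V.carrier) (xOp (k := k) W.carrier))

/-- The direct sum of two `k[x]`-modules. -/
def FDMod.sum (V W : FDMod k) : FDMod k where
  carrier := V.carrier × W.carrier

/-- The trivial module: `k`, on which `x` acts as the identity. -/
def FDMod.unit (k : Type u) [Field k] : FDMod k :=
  FDMod.ofOp (LinearMap.id : Module.End k k)

/-- The cyclic module `k[x]/(f)`, for `f ≠ 0`. -/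
def FDMod.cyclic (f : k[X]) (hf : f ≠ 0) : FDMod k where
  carrier := k[X] ⧸ Ideal.span {f}
  isScalarTower := Submodule.Quotient.isScalarTower ..
  finite := (AdjoinRoot.powerBasis hf).finite

/-- A module is indecomposable if it is nonzero and is not the direct sum of two nonzero
submodules. -/
def FDMod.Indecomposable (V : FDMod k) : Prop :=
  Nontrivial V.carrier ∧
    ∀ P Q : Submodule k[X] V.carrier, IsCompl P Q → P = ⊥ ∨ Q = ⊥

/-- A `k`-linear bijection that commutes with `x` is an isomorphism of `k[x]`-modules. -/
def equivOfX {V W : Type u} [AddCommGroup V] [Module k V] [Module k[X] V]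
    [IsScalarTower k k[X] V] [AddCommGroup W] [Module k W] [Module k[X] W]
    [IsScalarTower k k[X] W] (e : V ≃ₗ[k] W)
    (h : ∀ v, e ((Polynomial.X : k[X]) • v) = (Polynomial.X : k[X]) • e v) : V ≃ₗ[k[X]] W where
  __ := e
  map_smul' p v := by
    have hX : ∀ (n : ℕ) (v : V), e ((Polynomial.X ^ n : k[X]) • v)
        = (Polynomial.X ^ n : k[X]) • e v := by
      intro n
      induction n with
      | zero => intro v; simp
      | succ n ih => intro v; rw [pow_succ, mul_smul, ih, h, mul_smul]
    change e (p • v) = p • e v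
    induction p using Polynomial.induction_on' with
    | add p q hp hq => rw [add_smul, map_add, hp, hq, add_smul]
    | monomial n a =>
      rw [← Polynomial.C_mul_X_pow_eq_monomial, ← Polynomial.smul_eq_C_mul, smul_assoc,
        smul_assoc, map_smul, hX]

end

/-- Isomorphism of `k[x]`-modules. -/
instance isoSetoid (k : Type u) [Field k] : Setoid (FDMod k) where
  r V W := Nonempty (V.carrier ≃ₗ[k[X]] W.carrier)
  iseqv :=
    { refl := fun _ => ⟨LinearEquiv.refl _ _⟩
      symm := fun ⟨e⟩ => ⟨e.symm⟩
      trans := fun ⟨e⟩ ⟨f⟩ => ⟨e.trans f⟩ }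

/-- The isoclasses of finite-dimensional `k[x]`-modules. -/
def IsoClass (k : Type u) [Field k] : Type (u + 1) :=
  Quotient (isoSetoid k)

section

variable {k : Type u} [Field k]

/-- The isoclass of a module. -/
def FDMod.iso (V : FDMod k) : IsoClass k :=
  Quotient.mk (isoSetoid k) V

/-- Pure tensors, as elements of the module `V ⊗ W`. -/
def tensorEquiv (V W : FDMod k) :
    V.carrier ⊗[k] W.carrier ≃ₗ[k] (V.tensor W).carrier :=
  Module.AEval'.of _

theorem X_smul_tensorEquiv (V W : FDMod k) (t : V.carrier ⊗[k] W.carrier) :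
    (Polynomial.X : k[X]) • tensorEquiv V W t =
      tensorEquiv V W
        (TensorProduct.map (xOp (k := k) V.carrier) (xOp (k := k) W.carrier) t) :=
  Module.AEval'.X_smul_of _ _

/-- Isomorphisms out of a tensor product, from `k`-linear ones. -/
theorem iso_tensor_eq {V W U : FDMod k} (e : V.carrier ⊗[k] W.carrier ≃ₗ[k] U.carrier)
    (h : ∀ t, e (TensorProduct.map (xOp (k := k) V.carrier) (xOp (k := k) W.carrier) t)
      = (Polynomial.X : k[X]) • e t) : (V.tensor W).iso = U.iso := by
  refine Quotient.sound ⟨equivOfX ((tensorEquiv V W).symm.trans e) fun v => ?_⟩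
  obtain ⟨t, rfl⟩ := (tensorEquiv V W).surjective v
  rw [X_smul_tensorEquiv]
  simp [h]

theorem tensor_congr {V V' W W' : FDMod k} (e : V.carrier ≃ₗ[k[X]] V'.carrier)
    (f : W.carrier ≃ₗ[k[X]] W'.carrier) : (V.tensor W).iso = (V'.tensor W').iso := by
  refine iso_tensor_eq ((TensorProduct.congr (e.restrictScalars k)
    (f.restrictScalars k)).trans (tensorEquiv V' W')) fun t => ?_
  induction t with
  | zero => simp
  | add x y hx hy => rw [map_add, map_add, hx, hy, map_add, smul_add]
  | tmul v w => simp [X_smul_tensorEquiv]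

theorem tensor_comm (V W : FDMod k) : (V.tensor W).iso = (W.tensor V).iso := by
  refine iso_tensor_eq ((TensorProduct.comm k _ _).trans (tensorEquiv W V)) fun t => ?_
  induction t with
  | zero => simp
  | add x y hx hy => rw [map_add, map_add, hx, hy, map_add, smul_add]
  | tmul v w => simp [X_smul_tensorEquiv]

theorem tensor_assoc (U V W : FDMod k) :
    ((U.tensor V).tensor W).iso = (U.tensor (V.tensor W)).iso := by
  refine iso_tensor_eq (((TensorProduct.congr (tensorEquiv U V).symm
    (LinearEquiv.refl k W.carrier)).trans (TensorProduct.assoc k _ _ _)).trans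
    ((TensorProduct.congr (LinearEquiv.refl k U.carrier) (tensorEquiv V W)).trans
      (tensorEquiv U (V.tensor W)))) fun t => ?_
  induction t with
  | zero => simp
  | add x y hx hy => rw [map_add, map_add, hx, hy, map_add, smul_add]
  | tmul t w =>
    obtain ⟨t, rfl⟩ := (tensorEquiv U V).surjective t
    induction t with
    | zero => simp
    | add x y hx hy =>
      rw [map_add, TensorProduct.add_tmul, map_add, map_add, hx, hy, map_add, smul_add]
    | tmul u v => simp [X_smul_tensorEquiv]

/-- Elements of `k`, as elements of the trivial module. -/
def unitEquiv (k : Type u) [Field k] : k ≃ₗ[k] (FDMod.unit k).carrier :=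
  Module.AEval'.of _

theorem X_smul_unitEquiv (c : k) :
    (Polynomial.X : k[X]) • unitEquiv k c = unitEquiv k c :=
  Module.AEval'.X_smul_of _ _

theorem unit_tensor (V : FDMod k) : ((FDMod.unit k).tensor V).iso = V.iso := by
  refine iso_tensor_eq ((TensorProduct.congr (unitEquiv k).symm
    (LinearEquiv.refl k V.carrier)).trans (TensorProduct.lid k _)) fun t => ?_
  induction t with
  | zero => simp
  | add x y hx hy => rw [map_add, map_add, hx, hy, map_add, smul_add]
  | tmul c v =>
    obtain ⟨c, rfl⟩ := (unitEquiv k).surjective c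
    simp only [TensorProduct.map_tmul, xOp_apply, X_smul_unitEquiv, LinearEquiv.trans_apply,
      TensorProduct.congr_tmul, LinearEquiv.symm_apply_apply, LinearEquiv.refl_apply,
      TensorProduct.lid_tmul]
    exact ((xOp (k := k) V.carrier).map_smul c v).symm

end

/-- Isoclasses form a commutative monoid under `⊗`, with the class of the trivial module as
identity element. -/
instance (k : Type u) [Field k] : CommMonoid (IsoClass k) where
  mul := Quotient.map₂ FDMod.tensor fun _ _ ⟨e⟩ _ _ ⟨f⟩ => Quotient.exact (tensor_congr e f)
  one := (FDMod.unit k).iso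
  mul_assoc := by
    rintro ⟨U⟩ ⟨V⟩ ⟨W⟩
    exact tensor_assoc U V W
  mul_comm := by
    rintro ⟨V⟩ ⟨W⟩
    exact tensor_comm V W
  one_mul := by
    rintro ⟨V⟩
    exact unit_tensor V
  mul_one := by
    rintro ⟨V⟩
    exact (tensor_comm V _).trans (unit_tensor V)

/-- The elements `[V ⊕ W] - [V] - [W]` of the free abelian group on the isoclasses. They are
stable under `[U] ⊗ -`, so the ideal that they generate is also the subgroup that they generate. -/
def sumRelations (k : Type u) [Field k] : Set (MonoidAlgebra ℤ (IsoClass k)) :=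
  {r | ∃ V W : FDMod k, r = MonoidAlgebra.of ℤ (IsoClass k) (V.sum W).iso
    - MonoidAlgebra.of ℤ (IsoClass k) V.iso - MonoidAlgebra.of ℤ (IsoClass k) W.iso}

/-- The representation ring `R` of `k[x]`: the abelian group generated by the isoclasses `[V]` of
finite-dimensional `k[x]`-modules with the relations `[V ⊕ W] = [V] + [W]`, and with the product
`[V] [W] = [V ⊗ W]`. -/
abbrev RepRing (k : Type u) [Field k] : Type (u + 1) :=
  MonoidAlgebra ℤ (IsoClass k) ⧸ Ideal.span (sumRelations k)

section

variable {k : Type u} [Field k]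

/-- The element `[V]` of the representation ring, for an isoclass `V`. -/
def IsoClass.cls (c : IsoClass k) : RepRing k :=
  Ideal.Quotient.mk _ (MonoidAlgebra.of ℤ (IsoClass k) c)

/-- The element `[V]` of the representation ring. -/
def FDMod.cls (V : FDMod k) : RepRing k :=
  V.iso.cls

theorem FDMod.cls_sum (V W : FDMod k) : (V.sum W).cls = V.cls + W.cls := by
  have h := Ideal.Quotient.eq_zero_iff_mem.mpr
    (Ideal.subset_span (show _ ∈ sumRelations k from ⟨V, W, rfl⟩))
  rw [map_sub, map_sub, sub_sub, sub_eq_zero] at h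
  exact h

theorem FDMod.cls_tensor (V W : FDMod k) : (V.tensor W).cls = V.cls * W.cls := by
  have h : (V.tensor W).iso = V.iso * W.iso := rfl
  simp only [FDMod.cls, IsoClass.cls, h, map_mul]

/-- The dimension, as a multiplicative function on isoclasses. -/
def isoDim (k : Type u) [Field k] : IsoClass k →* ℤ where
  toFun := Quotient.lift (fun V => (Module.finrank k V.carrier : ℤ)) fun V W ⟨e⟩ => by
    exact congrArg Nat.cast (e.restrictScalars k).finrank_eq
  map_one' := by
    change ((Module.finrank k (FDMod.unit k).carrier : ℕ) : ℤ) = 1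
    rw [← (unitEquiv k).finrank_eq]
    simp
  map_mul' := by
    rintro ⟨V⟩ ⟨W⟩
    change ((Module.finrank k (V.tensor W).carrier : ℕ) : ℤ) = _
    rw [← (tensorEquiv V W).finrank_eq, Module.finrank_tensorProduct]
    push_cast
    rfl

/-- The ring morphism `dim : R → ℤ` with `dim [V] = dim V`. -/
def dim (k : Type u) [Field k] : RepRing k →+* ℤ :=
  Ideal.Quotient.lift _ (MonoidAlgebra.lift ℤ ℤ (IsoClass k) (isoDim k)).toRingHom (by
    intro a ha
    rw [← RingHom.mem_ker]
    refine (Ideal.span_le.mpr ?_) ha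
    rintro _ ⟨V, W, rfl⟩
    have h : isoDim k (V.sum W).iso = isoDim k V.iso + isoDim k W.iso := by
      change ((Module.finrank k (V.carrier × W.carrier) : ℕ) : ℤ) = _
      rw [Module.finrank_prod]
      push_cast
      rfl
    simp [RingHom.mem_ker, h])

theorem dim_cls (V : FDMod k) : dim k V.cls = (Module.finrank k V.carrier : ℤ) := by
  have h : dim k V.cls = isoDim k V.iso := by
    simp [dim, FDMod.cls, IsoClass.cls]
  rw [h]
  rfl

end

/-- The isoclasses of indecomposable modules. -/
def IndecClass (k : Type u) [Field k] : Type (u + 1) :=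
  {c : IsoClass k // ∃ V : FDMod k, V.Indecomposable ∧ V.iso = c}

/-- The span `R'` of all `[k[x]/(x-1)^s]`, `s ≥ 1`. -/
def unipotentSpan (k : Type u) [Field k] : AddSubgroup (RepRing k) :=
  AddSubgroup.closure {r | ∃ s : ℕ, 1 ≤ s ∧
    r = (FDMod.cyclic ((Polynomial.X - 1 : k[X]) ^ s)
      (pow_ne_zero s (Polynomial.X_sub_C_ne_zero 1))).cls}

/-- The span `R̄` of all `[k[x]/f]`, where `f` is irreducible and `f(0) ≠ 0`. -/
def simpleSpan (k : Type u) [Field k] : AddSubgroup (RepRing k) :=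
  AddSubgroup.closure {r | ∃ (f : k[X]) (hf : Irreducible f), f.eval 0 ≠ 0 ∧
    r = (FDMod.cyclic f hf.ne_zero).cls}

/-- The span `I` of all `[k[x]/x^s]`, `s ≥ 1`. -/
def nilpotentSpan (k : Type u) [Field k] : AddSubgroup (RepRing k) :=
  AddSubgroup.closure {r | ∃ s : ℕ, 1 ≤ s ∧
    r = (FDMod.cyclic ((Polynomial.X : k[X]) ^ s) (pow_ne_zero s Polynomial.X_ne_zero)).cls}

/-- The ring morphism `A ⊗ B → ℤ`, `a ⊗ b ↦ dim a * dim b`, for subrings `A` and `B` of `R`. -/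
def tensorDim {k : Type u} [Field k] (A B : Subring (RepRing k)) : A ⊗[ℤ] B →+* ℤ :=
  (Algebra.TensorProduct.productMap ((dim k).comp A.subtype).toIntAlgHom
    ((dim k).comp B.subtype).toIntAlgHom).toRingHom

theorem tensorDim_tmul {k : Type u} [Field k] (A B : Subring (RepRing k)) (a : A) (b : B) :
    tensorDim A B (a ⊗ₜ[ℤ] b) = dim k a * dim k b := by
  simp [tensorDim]

/-- The abelian group `T ⊕ I`, for a ring morphism `ε : T → ℤ` and an ideal `I`, to be made into a
ring in which `t ∈ T` acts on `I` by multiplication by the integer `ε t`. -/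
def DimSum {T R : Type*} [CommRing T] [CommRing R] (_ε : T →+* ℤ) (I : Ideal R) : Type _ :=
  T × I

namespace DimSum

variable {T R : Type*} [CommRing T] [CommRing R] {ε : T →+* ℤ} {I : Ideal R}

/-- The element `t + w` of `T ⊕ I`. -/
def mk (ε : T →+* ℤ) (t : T) (w : I) : DimSum ε I :=
  (t, w)

instance : AddCommGroup (DimSum ε I) :=
  inferInstanceAs (AddCommGroup (T × I))

/-- `(t + w) (t' + w') = t t' + (ε t • w' + ε t' • w + w w')`. -/
instance : Mul (DimSum ε I) :=
  ⟨fun p q => (p.1 * q.1, ε p.1 • q.2 + ε q.1 • p.2 + (p.2 : R) • q.2)⟩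

instance : One (DimSum ε I) :=
  ⟨(1, 0)⟩

theorem ext' {p q : DimSum ε I} (h₁ : p.1 = q.1) (h₂ : (p.2 : R) = (q.2 : R)) : p = q :=
  Prod.ext h₁ (Subtype.ext h₂)

theorem fst_mul (p q : DimSum ε I) : (p * q).1 = p.1 * q.1 :=
  rfl

theorem snd_mul (p q : DimSum ε I) : ((p * q).2 : R)
    = (ε p.1 : R) * (q.2 : R) + (ε q.1 : R) * (p.2 : R) + (p.2 : R) * (q.2 : R) := by
  change ((ε p.1 • q.2 + ε q.1 • p.2 + (p.2 : R) • q.2 : I) : R) = _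
  simp [zsmul_eq_mul]

theorem fst_add (p q : DimSum ε I) : (p + q).1 = p.1 + q.1 :=
  rfl

theorem snd_add (p q : DimSum ε I) : ((p + q).2 : R) = (p.2 : R) + (q.2 : R) :=
  rfl

theorem fst_one : (1 : DimSum ε I).1 = 1 :=
  rfl

theorem snd_one : ((1 : DimSum ε I).2 : R) = 0 :=
  rfl

theorem fst_zero : (0 : DimSum ε I).1 = 0 :=
  rfl

theorem snd_zero : ((0 : DimSum ε I).2 : R) = 0 :=
  rfl

theorem mul_comm' (p q : DimSum ε I) : p * q = q * p :=
  ext' (by simp only [fst_mul]; ring) (by simp only [snd_mul]; ring)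

theorem one_mul' (p : DimSum ε I) : 1 * p = p :=
  ext' (by simp [fst_mul, fst_one]) (by simp [snd_mul, fst_one, snd_one])

theorem left_distrib' (p q r : DimSum ε I) : p * (q + r) = p * q + p * r :=
  ext' (by simp only [fst_mul, fst_add]; ring)
    (by simp only [snd_mul, snd_add, fst_add, map_add, Int.cast_add]; ring)

theorem zero_mul' (p : DimSum ε I) : 0 * p = 0 :=
  ext' (by simp [fst_mul, fst_zero]) (by simp [snd_mul, fst_zero, snd_zero])

instance : CommRing (DimSum ε I) where
  __ := (inferInstance : AddCommGroup (DimSum ε I))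
  mul_assoc p q r := ext' (by simp only [fst_mul]; ring)
    (by simp only [snd_mul, fst_mul, map_mul, Int.cast_mul]; ring)
  one_mul := one_mul'
  mul_one p := (mul_comm' p 1).trans (one_mul' p)
  mul_comm := mul_comm'
  left_distrib := left_distrib'
  right_distrib p q r := by
    rw [mul_comm' (p + q) r, left_distrib', mul_comm' r p, mul_comm' r q]
  zero_mul := zero_mul'
  mul_zero p := (mul_comm' p 0).trans (zero_mul' p)

/-- An element `t` of `T` acts on `I` by multiplication by the integer `ε t`. -/
theorem mk_mul_mk (t : T) (w : I) : mk ε t 0 * mk ε 0 w = mk ε 0 (ε t • w) := by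
  refine ext' ((fst_mul _ _).trans (mul_zero t)) ((snd_mul _ _).trans ?_)
  change (ε t : R) * (w : R) + (ε 0 : R) * ((0 : I) : R) + ((0 : I) : R) * (w : R)
    = ((ε t • w : I) : R)
  simp

end DimSum

end PolyRep

end

/-!
The classes of the modules `k[x]/(f ^ s)`, for `f` monic irreducible and `s ≥ 1`, are a basis of
the representation ring `R`, and the map `φ` matches this basis with a similar decomposition of
`R' ⊗ R̄ ⊕ I`.

They span `R` by the structure theorem over the principal ideal domain `k[x]` (`FDMod.induction`,
`FDMod.cls_mem_of_kills`). They are linearly independent because `V ↦ dim (ker f ∩ f ^ i V) - dim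
(ker f ∩ f ^ (i + 1) V)` is additive on direct sums, hence defined on `R` (`liftAdd`), and
vanishes on all of them but `k[x]/(f ^ (i + 1))` (`multiplicity_self`, `multiplicity_of_ne`).
Uniqueness of decompositions is part of this independence. The same modules are, up to
isomorphism, the indecomposable ones (`jordanEquiv`).

That `R'`, `R̄` and `I` are closed under products is seen on operators: if `a - 1` and `b - 1` are
nilpotent, so is `a ⊗ b - 1`; if `a` and `b` are semisimple and bijective, so is `a ⊗ b`, since
`k` is perfect; if `b` is nilpotent, so is `a ⊗ b`.

Two tensor products remain. If `a` is bijective and `e i` is the basis `x ^ i` of `N = k[x]/(x ^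
s)`, then `v ⊗ e i ↦ a ^ i v ⊗ e i` turns `1 ⊗ x` into `a ⊗ x`, so that `[V] [N] = dim V [N]`
(`cls_mul_cyclic_X_pow`); this makes `φ` multiplicative. If `f` is irreducible with `f(0) ≠ 0`,
then in the algebra `k[x]/((x - 1) ^ s) ⊗ k[x]/(f)` the element `t = x ⊗ x` is `(1 + n) α`, with
`n ^ s = 0` and `f(α) = 0`. As `f` is separable, `f(t)` is a unit times `n`, so that `t` generates
a copy of `k[x]/(f ^ s)`, which is everything by dimension (`cls_unipotent_mul_simple`). So `φ`
takes `[k[x]/((x - 1) ^ s)] ⊗ [k[x]/(f)]` to the basis element `[k[x]/(f ^ s)]`, while the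
remaining basis elements `[k[x]/(x ^ s)]` span `I`; the inverse of `φ` is defined on the basis
(`splitMap`).
-/

noncomputable section

namespace PolyRep

variable {k : Type u} [Field k]

/-! ### Modules annihilated by a polynomial -/

theorem FDMod.iso_eq_iff {V W : FDMod k} :
    V.iso = W.iso ↔ Nonempty (V.carrier ≃ₗ[k[X]] W.carrier) :=
  Quotient.eq

theorem FDMod.cls_eq_of_equiv {V W : FDMod k} (e : V.carrier ≃ₗ[k[X]] W.carrier) :
    V.cls = W.cls :=
  congrArg IsoClass.cls (FDMod.iso_eq_iff.2 ⟨e⟩)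

/-- A polynomial `p` acts on a module as `p` of the operator `x`. -/
theorem aeval_xOp_apply {V : Type u} [AddCommGroup V] [Module k V] [Module k[X] V]
    [IsScalarTower k k[X] V] (p : k[X]) (v : V) :
    Polynomial.aeval (xOp (k := k) V) p v = p • v := by
  have h : Polynomial.aeval (xOp (k := k) V) p = Algebra.lsmul k k V p := by
    rw [xOp, Polynomial.aeval_algHom_apply, Polynomial.aeval_X_left_apply]
  rw [h]
  rfl

/-- The module `V` is annihilated by the polynomial `g`. -/
def FDMod.Kills (V : FDMod k) (g : k[X]) : Prop :=
  ∀ v : V.carrier, g • v = 0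

theorem FDMod.kills_iff (V : FDMod k) (g : k[X]) :
    V.Kills g ↔ Polynomial.aeval (xOp (k := k) V.carrier) g = 0 := by
  simp only [FDMod.Kills, LinearMap.ext_iff, aeval_xOp_apply, LinearMap.zero_apply]

theorem FDMod.Kills.congr {V W : FDMod k} {g : k[X]} (h : V.Kills g)
    (e : V.carrier ≃ₗ[k[X]] W.carrier) : W.Kills g := fun w => by
  rw [← e.apply_symm_apply w, ← map_smul, h, map_zero]

theorem FDMod.kills_minpoly (V : FDMod k) : V.Kills (minpoly k (xOp (k := k) V.carrier)) :=
  (V.kills_iff _).2 (minpoly.aeval _ _)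

theorem FDMod.minpoly_ne_zero (V : FDMod k) : minpoly k (xOp (k := k) V.carrier) ≠ 0 :=
  minpoly.ne_zero (Algebra.IsIntegral.isIntegral _)

theorem FDMod.kills_cyclic_iff (f : k[X]) (hf : f ≠ 0) (g : k[X]) :
    (FDMod.cyclic f hf).Kills g ↔ f ∣ g := by
  rw [← Ideal.mem_span_singleton]
  constructor
  · intro h
    have h1 : Submodule.Quotient.mk (p := Ideal.span {f}) (g • (1 : k[X])) = 0 :=
      h (Submodule.Quotient.mk (p := Ideal.span {f}) 1)
    rwa [smul_eq_mul, mul_one, Submodule.Quotient.mk_eq_zero] at h1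
  · intro h v
    obtain ⟨p, rfl⟩ := Ideal.Quotient.mk_surjective (I := Ideal.span {f}) v
    exact (Submodule.Quotient.mk_eq_zero (Ideal.span {f})).2 (Ideal.mul_mem_right p _ h)

theorem FDMod.cyclic_kills (f : k[X]) (hf : f ≠ 0) : (FDMod.cyclic f hf).Kills f :=
  (FDMod.kills_cyclic_iff f hf f).2 dvd_rfl

theorem FDMod.cls_of_subsingleton (V : FDMod k) [Subsingleton V.carrier] : V.cls = 0 := by
  have e : (V.sum V).carrier ≃ₗ[k[X]] V.carrier :=
    { (0 : (V.carrier × V.carrier) →ₗ[k[X]] V.carrier) with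
      invFun := 0
      left_inv := fun _ => Subsingleton.elim (α := V.carrier × V.carrier) _ _
      right_inv := fun _ => Subsingleton.elim _ _ }
  have h := FDMod.cls_sum V V
  rw [FDMod.cls_eq_of_equiv e] at h
  simpa using h

/-- The structure theorem for finitely generated torsion modules over the principal ideal domain
`k[x]`, as an induction principle. -/
theorem FDMod.induction {P : FDMod k → Prop}
    (hiso : ∀ V W : FDMod k, (V.carrier ≃ₗ[k[X]] W.carrier) → P V → P W)
    (hzero : ∀ V : FDMod k, Subsingleton V.carrier → P V)
    (hcyc : ∀ (f : k[X]) (s : ℕ) (hf : Irreducible f),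
      P (FDMod.cyclic (f ^ (s + 1)) (pow_ne_zero _ hf.ne_zero)))
    (hsum : ∀ V W : FDMod k, P V → P W → P (V.sum W)) (V : FDMod k) : P V := by
  -- a finite product of modules satisfies `P` if its factors do
  have key : ∀ (n : ℕ) (M : Fin n → FDMod k), (∀ i, P (M i)) →
      P { carrier := ∀ i, (M i).carrier } := by
    intro n
    induction n with
    | zero => exact fun M _ => hzero _ (inferInstanceAs (Subsingleton (∀ i, (M i).carrier)))
    | succ n ih =>
      intro M hM
      exact hiso _ _ (Fin.consLinearEquiv k[X] fun i => (M i).carrier)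
        (hsum (M 0) _ (hM 0) (ih (fun i => M i.succ) fun i => hM i.succ))
  have hfin : Module.Finite k[X] V.carrier := Module.Finite.of_restrictScalars_finite k _ _
  have htors : Module.IsTorsion k[X] V.carrier := fun {v} =>
    ⟨⟨_, mem_nonZeroDivisors_of_ne_zero V.minpoly_ne_zero⟩, V.kills_minpoly v⟩
  obtain ⟨ι, _, p, hp, e, ⟨φ⟩⟩ := Module.equiv_directSum_of_isTorsion htors
  classical
  let M : Fin (Fintype.card ι) → FDMod k := fun i =>
    FDMod.cyclic (p ((Fintype.equivFin ι).symm i) ^ e ((Fintype.equivFin ι).symm i))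
      (pow_ne_zero _ (hp _).ne_zero)
  have hM : ∀ i, P (M i) := by
    intro i
    change P (FDMod.cyclic (p ((Fintype.equivFin ι).symm i) ^ e ((Fintype.equivFin ι).symm i)) _)
    generalize (Fintype.equivFin ι).symm i = j
    rcases h : e j with _ | s
    · refine hzero _ ?_
      refine ⟨fun a b => ?_⟩
      have h1 := (FDMod.kills_cyclic_iff (p j ^ 0) (pow_ne_zero _ (hp _).ne_zero) 1).2 (by simp)
      rw [← one_smul k[X] a, h1 a, ← one_smul k[X] b, h1 b]
    · exact hcyc _ _ (hp j)
  refine hiso _ _ ?_ (key _ M hM)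
  have ψ := φ.trans (DirectSum.linearEquivFunOnFintype k[X] ι
    fun i => k[X] ⧸ Submodule.span k[X] {p i ^ e i})
  have χ := LinearEquiv.piCongrLeft k[X]
    (fun i => k[X] ⧸ Submodule.span k[X] {p i ^ e i}) (Fintype.equivFin ι).symm
  exact χ.trans ψ.symm

/-- If the module `V` is annihilated by `g`, then its class is a sum of classes of modules
`k[x]/(f ^ s)`, where `f` is irreducible and `f ^ s` divides `g`. -/
theorem FDMod.cls_mem_of_kills (V : FDMod k) {g : k[X]} (hV : V.Kills g)
    (S : AddSubgroup (RepRing k))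
    (hS : ∀ (f : k[X]) (s : ℕ) (hf : Irreducible f), f ^ (s + 1) ∣ g →
      (FDMod.cyclic (f ^ (s + 1)) (pow_ne_zero _ hf.ne_zero)).cls ∈ S) : V.cls ∈ S := by
  induction V using FDMod.induction with
  | hiso V W e ih =>
    rw [← FDMod.cls_eq_of_equiv e]
    exact ih (hV.congr e.symm)
  | hzero V h =>
    rw [V.cls_of_subsingleton]
    exact S.zero_mem
  | hcyc f s hf => exact hS f s hf ((FDMod.kills_cyclic_iff _ _ _).1 hV)
  | hsum V W ihV ihW =>
    rw [FDMod.cls_sum]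
    exact S.add_mem (ihV fun v => congrArg Prod.fst (hV (v, 0)))
      (ihW fun w => congrArg Prod.snd (hV (0, w)))

/-- The representation ring is generated by the classes of modules, as an abelian group. -/
theorem RepRing.mem_of_cls_mem (S : AddSubgroup (RepRing k)) (hS : ∀ V : FDMod k, V.cls ∈ S)
    (r : RepRing k) : r ∈ S := by
  obtain ⟨a, rfl⟩ := Ideal.Quotient.mk_surjective r
  induction a using MonoidAlgebra.induction_on with
  | of c =>
    obtain ⟨V, rfl⟩ := Quotient.exists_rep c
    exact hS V
  | add a b ha hb =>
    rw [map_add]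
    exact S.add_mem ha hb
  | smul n a ha =>
    rw [map_zsmul]
    exact S.zsmul_mem ha n

/-! ### Additive functions on the representation ring -/

/-- Compatibility with `x` need only be checked on pure tensors. -/
theorem iso_tensor_of_tmul {V W U : FDMod k} (e : V.carrier ⊗[k] W.carrier ≃ₗ[k] U.carrier)
    (h : ∀ v w, e (((Polynomial.X : k[X]) • v) ⊗ₜ ((Polynomial.X : k[X]) • w))
      = (Polynomial.X : k[X]) • e (v ⊗ₜ w)) : (V.tensor W).iso = U.iso := by
  refine iso_tensor_eq e fun t => ?_
  induction t with
  | zero => simp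
  | add x y hx hy => rw [map_add, map_add, hx, hy, map_add, smul_add]
  | tmul v w => exact h v w

/-- Direct sums distribute over tensor products. -/
theorem tensor_sum (U V W : FDMod k) :
    (U.tensor (V.sum W)).iso = ((U.tensor V).sum (U.tensor W)).iso := by
  refine iso_tensor_of_tmul (V := U) (W := V.sum W) (U := (U.tensor V).sum (U.tensor W))
    ((TensorProduct.prodRight k k U.carrier V.carrier W.carrier).trans
      ((tensorEquiv U V).prodCongr (tensorEquiv U W))) fun u p => Prod.ext ?_ ?_
  · exact (X_smul_tensorEquiv U V (u ⊗ₜ p.1)).symm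
  · exact (X_smul_tensorEquiv U W (u ⊗ₜ p.2)).symm

/-- The linear extension to the monoid algebra of an integer-valued function on isoclasses. -/
def isoLinear (F : IsoClass k → ℤ) : MonoidAlgebra ℤ (IsoClass k) →+ ℤ :=
  (Finsupp.liftAddHom fun c => (AddMonoidHom.mulRight (F c))).comp
    MonoidAlgebra.coeffAddEquiv.toAddMonoidHom

theorem isoLinear_of (F : IsoClass k → ℤ) (c : IsoClass k) :
    isoLinear F (MonoidAlgebra.of ℤ _ c) = F c := by
  simp [isoLinear]

/-- A function on isoclasses that is additive on direct sums extends to the representation ring.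
The relations generate, as a group, an ideal, because tensor products distribute over direct
sums. -/
def liftAdd (F : IsoClass k → ℤ)
    (hF : ∀ V W : FDMod k, F (V.sum W).iso = F V.iso + F W.iso) : RepRing k →+ ℤ :=
  QuotientAddGroup.lift _ (isoLinear F) (by
    intro a ha
    -- the claim for all multiples of `a` is stable under the operations of an ideal
    suffices h : ∀ b, isoLinear F (b * a) = 0 by
      simpa using h 1
    have ha' : a ∈ Ideal.span (sumRelations k) := ha
    induction ha' using Submodule.span_induction with
    | mem r hr =>
      obtain ⟨V, W, rfl⟩ := hr
      intro b
      induction b using MonoidAlgebra.induction_on with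
      | of c =>
        obtain ⟨U, rfl⟩ := Quotient.exists_rep c
        have h : F (U.iso * (V.sum W).iso) = F (U.iso * V.iso) + F (U.iso * W.iso) :=
          (congrArg F (tensor_sum U V W)).trans (hF _ _)
        change isoLinear F (MonoidAlgebra.of ℤ _ U.iso * _) = 0
        rw [mul_sub, mul_sub, ← map_mul, ← map_mul, ← map_mul, map_sub, map_sub,
          isoLinear_of, isoLinear_of, isoLinear_of]
        rw [h]
        ring
      | add a b ha hb => rw [add_mul, map_add, ha, hb, add_zero]
      | smul n a ha => rw [smul_mul_assoc, map_zsmul, ha, smul_zero]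
    | zero => simp
    | add x y hx hy ihx ihy => exact fun b => by rw [mul_add, map_add, ihx hx, ihy hy, add_zero]
    | smul c x hx ih => exact fun b => by rw [smul_eq_mul, ← mul_assoc, ih hx])

theorem liftAdd_cls (F : IsoClass k → ℤ)
    (hF : ∀ V W : FDMod k, F (V.sum W).iso = F V.iso + F W.iso) (V : FDMod k) :
    liftAdd F hF V.cls = F V.iso :=
  isoLinear_of F V.iso

/-! ### Multiplicities of the indecomposable modules -/

/-- The submodule `ker f ∩ f ^ i V` of `V`. -/
def FDMod.layer (f : k[X]) (i : ℕ) (V : FDMod k) : Submodule k[X] V.carrier :=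
  LinearMap.ker (LinearMap.lsmul k[X] V.carrier f) ⊓
    LinearMap.range (LinearMap.lsmul k[X] V.carrier (f ^ i))

theorem FDMod.mem_layer {f : k[X]} {i : ℕ} {V : FDMod k} {v : V.carrier} :
    v ∈ V.layer f i ↔ f • v = 0 ∧ ∃ w : V.carrier, f ^ i • w = v :=
  Iff.rfl

theorem FDMod.map_layer (f : k[X]) (i : ℕ) {V W : FDMod k} (e : V.carrier ≃ₗ[k[X]] W.carrier) :
    (V.layer f i).map (e : V.carrier →ₗ[k[X]] W.carrier) = W.layer f i := by
  ext w
  simp only [Submodule.mem_map, FDMod.mem_layer]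
  constructor
  · rintro ⟨v, ⟨hv, u, rfl⟩, rfl⟩
    exact ⟨by rw [LinearEquiv.coe_coe, ← map_smul, hv, map_zero], e u,
      (map_smul e (f ^ i) u).symm⟩
  · rintro ⟨hw, u, rfl⟩
    refine ⟨f ^ i • e.symm u, ⟨?_, e.symm u, rfl⟩, by simp⟩
    rw [← map_smul, ← map_smul, hw, map_zero]

/-- The dimension of `ker f ∩ f ^ i V`, as a function of the isoclass of `V`. -/
def layerDim (f : k[X]) (i : ℕ) : IsoClass k → ℤ :=
  Quotient.lift (fun V => (Module.finrank k (V.layer f i) : ℤ)) fun _ _ ⟨e⟩ =>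
    congrArg Nat.cast
      ((e.ofSubmodules _ _ (FDMod.map_layer f i e)).restrictScalars k).finrank_eq

theorem layerDim_iso (f : k[X]) (i : ℕ) (V : FDMod k) :
    layerDim f i V.iso = Module.finrank k (V.layer f i) :=
  rfl

theorem layerDim_sum (f : k[X]) (i : ℕ) (V W : FDMod k) :
    layerDim f i (V.sum W).iso = layerDim f i V.iso + layerDim f i W.iso := by
  have hmem : ∀ p : V.carrier × W.carrier,
      p ∈ (V.sum W).layer f i ↔ p.1 ∈ V.layer f i ∧ p.2 ∈ W.layer f i := by
    intro p
    constructor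
    · rintro ⟨h, w, rfl⟩
      exact ⟨⟨congrArg Prod.fst h, w.1, rfl⟩, ⟨congrArg Prod.snd h, w.2, rfl⟩⟩
    · rintro ⟨⟨h, v, hv⟩, ⟨h', w, hw⟩⟩
      exact ⟨Prod.ext h h', (v, w), Prod.ext hv hw⟩
  let e : ((V.sum W).layer f i) ≃ₗ[k] (V.layer f i × W.layer f i) :=
    { toFun := fun p => (⟨p.1.1, ((hmem p.1).1 p.2).1⟩, ⟨p.1.2, ((hmem p.1).1 p.2).2⟩)
      invFun := fun q => ⟨(q.1.1, q.2.1), (hmem _).2 ⟨q.1.2, q.2.2⟩⟩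
      map_add' := fun _ _ => rfl
      map_smul' := fun _ _ => rfl
      left_inv := fun _ => rfl
      right_inv := fun _ => rfl }
  have hV : Module.Finite k (V.layer f i) :=
    inferInstanceAs (Module.Finite k ((V.layer f i).restrictScalars k))
  have hW : Module.Finite k (W.layer f i) :=
    inferInstanceAs (Module.Finite k ((W.layer f i).restrictScalars k))
  rw [layerDim_iso, layerDim_iso, layerDim_iso, e.finrank_eq, Module.finrank_prod, Nat.cast_add]

/-- The class of `p` in the module `k[x]/(f)`. -/
def cyclicMk (f : k[X]) (hf : f ≠ 0) : k[X] →ₗ[k[X]] (FDMod.cyclic f hf).carrier :=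
  Submodule.mkQ (Ideal.span {f})

theorem cyclicMk_surjective (f : k[X]) (hf : f ≠ 0) : Function.Surjective (cyclicMk f hf) :=
  Submodule.mkQ_surjective _

theorem cyclicMk_eq_zero_iff {f : k[X]} {hf : f ≠ 0} {p : k[X]} :
    cyclicMk f hf p = 0 ↔ f ∣ p :=
  (Submodule.Quotient.mk_eq_zero (Ideal.span {f})).trans Ideal.mem_span_singleton

theorem smul_cyclicMk {f : k[X]} {hf : f ≠ 0} (g p : k[X]) :
    g • cyclicMk f hf p = cyclicMk f hf (g * p) :=
  ((cyclicMk f hf).map_smul g p).symm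

theorem layer_eq_bot_of_isCoprime {f g : k[X]} (h : IsCoprime f g) (i : ℕ) {V : FDMod k}
    (hV : V.Kills g) : V.layer f i = ⊥ := by
  refine (Submodule.eq_bot_iff _).2 fun v hv => ?_
  obtain ⟨a, b, hab⟩ := h
  rw [← one_smul k[X] v, ← hab, add_smul, mul_smul, mul_smul, (FDMod.mem_layer.1 hv).1,
    hV v, smul_zero, smul_zero, add_zero]

theorem layer_eq_bot_of_kills {f : k[X]} {i : ℕ} {V : FDMod k} (hV : V.Kills (f ^ i)) :
    V.layer f i = ⊥ := by
  refine (Submodule.eq_bot_iff _).2 fun v hv => ?_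
  obtain ⟨-, w, rfl⟩ := hv
  exact hV w

/-- For `i ≤ t`, the kernel of `f` in `k[x]/(f ^ (t + 1))`, which is generated by `f ^ t`, lies
in the image of `f ^ i`. -/
theorem layer_cyclic_eq {f : k[X]} (hf : f ≠ 0) {i t : ℕ} (hi : i ≤ t) :
    (FDMod.cyclic (f ^ (t + 1)) (pow_ne_zero _ hf)).layer f i =
      (FDMod.cyclic (f ^ (t + 1)) (pow_ne_zero _ hf)).layer f 0 := by
  ext v
  refine ⟨fun h => ⟨h.1, v, by simp⟩, fun h => ⟨h.1, ?_⟩⟩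
  have hv := h.1
  obtain ⟨p, rfl⟩ := cyclicMk_surjective _ _ v
  have hv' : f • cyclicMk _ (pow_ne_zero (t + 1) hf) p = 0 := hv
  rw [smul_cyclicMk, cyclicMk_eq_zero_iff, pow_succ', mul_dvd_mul_iff_left hf] at hv'
  obtain ⟨q, rfl⟩ := hv'
  refine ⟨cyclicMk _ _ (f ^ (t - i) * q), ?_⟩
  change f ^ i • cyclicMk _ (pow_ne_zero (t + 1) hf) (f ^ (t - i) * q) = _
  rw [smul_cyclicMk, ← mul_assoc, ← pow_add, Nat.add_sub_cancel' hi]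

theorem finrank_layer_cyclic_ne_zero {f : k[X]} (hf : Irreducible f) (t : ℕ) :
    Module.finrank k ((FDMod.cyclic (f ^ (t + 1)) (pow_ne_zero _ hf.ne_zero)).layer f 0) ≠ 0 := by
  set V := FDMod.cyclic (f ^ (t + 1)) (pow_ne_zero _ hf.ne_zero)
  have hV : Module.Finite k (V.layer f 0) :=
    inferInstanceAs (Module.Finite k ((V.layer f 0).restrictScalars k))
  intro h
  have h1 : cyclicMk _ (pow_ne_zero (t + 1) hf.ne_zero) (f ^ t) ∈ V.layer f 0 := by
    refine ⟨?_, cyclicMk _ (pow_ne_zero (t + 1) hf.ne_zero) (f ^ t), by simp⟩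
    change f • cyclicMk _ (pow_ne_zero (t + 1) hf.ne_zero) (f ^ t) = 0
    rw [smul_cyclicMk, cyclicMk_eq_zero_iff, pow_succ']
  have h2 := Module.finrank_zero_iff.1 h
  have h3 : cyclicMk _ (pow_ne_zero (t + 1) hf.ne_zero) (f ^ t) = 0 :=
    congrArg Subtype.val (Subsingleton.elim (⟨_, h1⟩ : V.layer f 0) 0)
  rw [cyclicMk_eq_zero_iff, pow_dvd_pow_iff hf.ne_zero hf.not_isUnit] at h3
  omega

/-- The pairs `(f, s)` that index the indecomposable modules `k[x]/(f ^ (s + 1))`: here `f` is a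
monic irreducible polynomial. -/
abbrev JordanIndex (k : Type u) [Field k] : Type u :=
  {f : k[X] // f.Monic ∧ Irreducible f} × ℕ

/-- The module `k[x]/(f ^ (s + 1))`. -/
def jordan (j : JordanIndex k) : FDMod k :=
  FDMod.cyclic (j.1.1 ^ (j.2 + 1)) (pow_ne_zero _ j.1.2.1.ne_zero)

/-- The additive function on the representation ring that takes a module to a nonzero multiple of
the multiplicity of `k[x]/(f ^ (s + 1))` in it. -/
def multiplicity (j : JordanIndex k) : RepRing k →+ ℤ :=
  liftAdd (layerDim j.1.1 j.2) (layerDim_sum _ _) -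
    liftAdd (layerDim j.1.1 (j.2 + 1)) (layerDim_sum _ _)

theorem multiplicity_cls (j : JordanIndex k) (V : FDMod k) : multiplicity j V.cls =
    Module.finrank k (V.layer j.1.1 j.2) - Module.finrank k (V.layer j.1.1 (j.2 + 1)) := by
  rw [multiplicity, AddMonoidHom.sub_apply, liftAdd_cls, liftAdd_cls, layerDim_iso, layerDim_iso]

theorem multiplicity_self (j : JordanIndex k) : multiplicity j (jordan j).cls ≠ 0 := by
  obtain ⟨⟨f, hf, hfi⟩, s⟩ := j
  have h1 : (jordan (⟨f, hf, hfi⟩, s)).layer f s = (jordan (⟨f, hf, hfi⟩, s)).layer f 0 :=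
    layer_cyclic_eq hf.ne_zero le_rfl
  have h2 : (jordan (⟨f, hf, hfi⟩, s)).layer f (s + 1) = ⊥ :=
    layer_eq_bot_of_kills (FDMod.cyclic_kills _ _)
  have h4 : Module.finrank k (⊥ : Submodule k[X] (jordan (⟨f, hf, hfi⟩, s)).carrier) = 0 :=
    Module.finrank_zero_of_subsingleton
  have h3 := finrank_layer_cyclic_ne_zero hfi s
  rw [multiplicity_cls, h1, h2, h4, Nat.cast_zero, sub_zero]
  exact Nat.cast_ne_zero.2 h3

theorem isCoprime_of_monic_of_ne {f g : k[X]} (hf : f.Monic) (hfi : Irreducible f) (hg : g.Monic)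
    (hgi : Irreducible g) (h : f ≠ g) : IsCoprime f g :=
  (hfi.coprime_iff_not_dvd).2 fun hd =>
    h (Polynomial.eq_of_monic_of_associated hf hg (hfi.associated_of_dvd hgi hd))

theorem multiplicity_of_ne {i j : JordanIndex k} (h : i ≠ j) :
    multiplicity i (jordan j).cls = 0 := by
  obtain ⟨⟨f, hf, hfi⟩, s⟩ := i
  obtain ⟨⟨g, hg, hgi⟩, t⟩ := j
  rw [multiplicity_cls]
  have hk : (jordan (⟨g, hg, hgi⟩, t)).Kills (g ^ (t + 1)) :=
    FDMod.cyclic_kills _ _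
  by_cases hfg : f = g
  · subst hfg
    rcases lt_trichotomy s t with hst | hst | hst
    · have h1 : ∀ i ≤ t, (jordan (⟨f, hf, hfi⟩, t)).layer f i
          = (jordan (⟨f, hf, hfi⟩, t)).layer f 0 :=
        fun i hi => layer_cyclic_eq hf.ne_zero hi
      rw [h1 s hst.le, h1 (s + 1) hst, sub_self]
    · exact absurd (by rw [hst]) h
    · have h1 : ∀ i, t + 1 ≤ i → (jordan (⟨f, hf, hfi⟩, t)).layer f i = ⊥ := fun i hi =>
        layer_eq_bot_of_kills ((FDMod.kills_cyclic_iff _ _ _).2 (pow_dvd_pow _ hi))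
      rw [h1 s hst, h1 (s + 1) (by omega), sub_self]
  · have hc := (isCoprime_of_monic_of_ne hf hfi hg hgi hfg).pow_right (n := t + 1)
    rw [layer_eq_bot_of_isCoprime hc _ hk, layer_eq_bot_of_isCoprime hc _ hk, sub_self]

theorem linearIndependent_jordan :
    LinearIndependent ℤ fun j : JordanIndex k => (jordan j).cls := by
  rw [linearIndependent_iff]
  intro l hl
  ext j
  have h := congrArg (multiplicity j) hl
  rw [Finsupp.linearCombination_apply, Finsupp.sum, map_sum, map_zero,
    Finset.sum_eq_single j] at h
  · rw [map_zsmul, smul_eq_mul] at h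
    exact (mul_eq_zero.1 h).resolve_right (multiplicity_self j)
  · intro i _ hi
    rw [map_zsmul, multiplicity_of_ne hi.symm, smul_zero]
  · intro hj
    rw [Finsupp.notMem_support_iff.1 hj, zero_smul, map_zero]

/-! ### The basis of indecomposable modules -/

theorem cyclic_equiv {f g : k[X]} (h : Associated f g) (hf : f ≠ 0) (hg : g ≠ 0) :
    Nonempty ((FDMod.cyclic f hf).carrier ≃ₗ[k[X]] (FDMod.cyclic g hg).carrier) :=
  ⟨Submodule.quotEquivOfEq (Ideal.span {f}) (Ideal.span {g})
    (Ideal.span_singleton_eq_span_singleton.2 h)⟩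

theorem cyclic_cls_congr {f g : k[X]} (h : Associated f g) (hf : f ≠ 0) (hg : g ≠ 0) :
    (FDMod.cyclic f hf).cls = (FDMod.cyclic g hg).cls :=
  let ⟨e⟩ := cyclic_equiv h hf hg
  FDMod.cls_eq_of_equiv e

theorem exists_monic_associated {f : k[X]} (hf : Irreducible f) :
    ∃ g : {g : k[X] // g.Monic ∧ Irreducible g}, Associated f g.1 := by
  have h : Associated f (f * Polynomial.C f.leadingCoeff⁻¹) :=
    associated_mul_unit_right _ _ (Polynomial.isUnit_C.2
      (inv_ne_zero (Polynomial.leadingCoeff_ne_zero.2 hf.ne_zero)).isUnit)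
  exact ⟨⟨_, Polynomial.monic_mul_leadingCoeff_inv hf.ne_zero, h.irreducible hf⟩, h⟩

theorem span_jordan : ⊤ ≤ Submodule.span ℤ (Set.range fun j : JordanIndex k => (jordan j).cls) := by
  intro r _
  refine RepRing.mem_of_cls_mem
    (Submodule.span ℤ (Set.range fun j : JordanIndex k => (jordan j).cls)).toAddSubgroup
    (fun V => V.cls_mem_of_kills V.kills_minpoly _ fun f s hf _ => ?_) r
  obtain ⟨g, hg⟩ := exists_monic_associated hf
  exact Submodule.subset_span
    ⟨(g, s), cyclic_cls_congr (hg.symm.pow_pow (n := s + 1)) _ _⟩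

/-- The basis of the representation ring that consists of the classes of the modules
`k[x]/(f ^ (s + 1))`. -/
def jordanBasis (k : Type u) [Field k] : Module.Basis (JordanIndex k) ℤ (RepRing k) :=
  Module.Basis.mk linearIndependent_jordan span_jordan

@[simp]
theorem jordanBasis_apply (j : JordanIndex k) : jordanBasis k j = (jordan j).cls :=
  Module.Basis.mk_apply _ _ j

/-- In a decomposition of `k[x]/(f ^ (t + 1))`, one of the components of the generator is not killed
by `f ^ t`, and thus generates the module. -/
theorem cyclic_pow_indecomposable {f : k[X]} (hf : Irreducible f) (t : ℕ) :
    (FDMod.cyclic (f ^ (t + 1)) (pow_ne_zero _ hf.ne_zero)).Indecomposable := by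
  have hne := pow_ne_zero (t + 1) hf.ne_zero
  -- a submodule that contains an element `u` with `f ^ t u ≠ 0` is the whole module
  have key : ∀ (P : Submodule k[X] (FDMod.cyclic (f ^ (t + 1)) hne).carrier) (u), u ∈ P →
      f ^ t • u ≠ 0 → P = ⊤ := by
    intro P u hu h
    obtain ⟨p, rfl⟩ := cyclicMk_surjective _ hne u
    have hp : ¬ f ∣ p := fun hd => h (by
      rw [smul_cyclicMk, cyclicMk_eq_zero_iff, pow_succ]
      exact mul_dvd_mul_left _ hd)
    obtain ⟨a, b, hab⟩ := ((hf.coprime_iff_not_dvd).2 hp).pow_left (m := t + 1)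
    refine Submodule.eq_top_iff'.2 fun v => ?_
    obtain ⟨q, rfl⟩ := cyclicMk_surjective _ hne v
    have hq : cyclicMk _ hne q = (q * b) • cyclicMk _ hne p := by
      rw [smul_cyclicMk, ← sub_eq_zero, ← map_sub, cyclicMk_eq_zero_iff]
      exact ⟨q * a, by linear_combination (-q) * hab⟩
    rw [hq]
    exact P.smul_mem _ hu
  have h1 : f ^ t • cyclicMk _ hne 1 ≠ 0 := by
    rw [smul_cyclicMk, mul_one, Ne, cyclicMk_eq_zero_iff,
      pow_dvd_pow_iff hf.ne_zero hf.not_isUnit]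
    omega
  refine ⟨⟨_, _, h1⟩, fun P Q hPQ => ?_⟩
  obtain ⟨p, hp, q, hq, hpq⟩ := Submodule.mem_sup.1
    (hPQ.sup_eq_top.ge (Submodule.mem_top (x := cyclicMk _ hne 1)))
  by_cases h : f ^ t • p = 0
  · have h2 : f ^ t • q ≠ 0 := fun h2 => h1 (by
      rw [← hpq, smul_add, h, h2, add_zero])
    exact Or.inl (eq_bot_of_isCompl_top (key Q q hq h2 ▸ hPQ))
  · exact Or.inr (eq_bot_of_top_isCompl (key P p hp h ▸ hPQ))

theorem FDMod.Indecomposable.congr {V W : FDMod k} (h : V.Indecomposable)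
    (e : V.carrier ≃ₗ[k[X]] W.carrier) : W.Indecomposable := by
  refine ⟨have := h.1; e.symm.toEquiv.nontrivial, fun P Q hPQ => ?_⟩
  have h1 := h.2 _ _ (hPQ.map (Submodule.orderIsoMapComap e.symm))
  exact h1.imp (fun h => by simpa using h) (fun h => by simpa using h)

theorem FDMod.Indecomposable.exists_jordan {V : FDMod k} (h : V.Indecomposable) :
    ∃ j, (jordan j).iso = V.iso := by
  induction V using FDMod.induction with
  | hiso V W e ih =>
    obtain ⟨j, hj⟩ := ih (h.congr e.symm)
    exact ⟨j, hj.trans (FDMod.iso_eq_iff.2 ⟨e⟩)⟩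
  | hzero V hV => exact absurd h.1 (not_nontrivial_iff_subsingleton.2 hV)
  | hcyc f s hf =>
    obtain ⟨g, hg⟩ := exists_monic_associated hf
    exact ⟨(g, s), FDMod.iso_eq_iff.2 (cyclic_equiv (hg.symm.pow_pow (n := s + 1)) _ _)⟩
  | hsum V W ihV ihW =>
    rcases h.2 _ _ (LinearMap.isCompl_range_inl_inr (R := k[X]) (M := V.carrier)
      (M₂ := W.carrier)) with h0 | h0
    · have hV : Subsingleton V.carrier := subsingleton_of_forall_eq 0 fun v =>
        congrArg Prod.fst ((Submodule.eq_bot_iff _).1 h0 (v, 0) ⟨v, rfl⟩)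
      have e : (V.sum W).carrier ≃ₗ[k[X]] W.carrier :=
        { LinearMap.snd k[X] V.carrier W.carrier with
          invFun := fun w => (0, w)
          left_inv := fun p => Prod.ext (Subsingleton.elim _ _) rfl
          right_inv := fun _ => rfl }
      obtain ⟨j, hj⟩ := ihW (h.congr e)
      exact ⟨j, hj.trans (FDMod.iso_eq_iff.2 ⟨e.symm⟩)⟩
    · have hW : Subsingleton W.carrier := subsingleton_of_forall_eq 0 fun w =>
        congrArg Prod.snd ((Submodule.eq_bot_iff _).1 h0 (0, w) ⟨w, rfl⟩)
      have e : (V.sum W).carrier ≃ₗ[k[X]] V.carrier :=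
        { LinearMap.fst k[X] V.carrier W.carrier with
          invFun := fun v => (v, 0)
          left_inv := fun p => Prod.ext rfl (Subsingleton.elim _ _)
          right_inv := fun _ => rfl }
      obtain ⟨j, hj⟩ := ihV (h.congr e)
      exact ⟨j, hj.trans (FDMod.iso_eq_iff.2 ⟨e.symm⟩)⟩

/-- The isoclasses of indecomposable modules are those of the modules `k[x]/(f ^ (s + 1))`. -/
def jordanEquiv (k : Type u) [Field k] : JordanIndex k ≃ IndecClass k :=
  Equiv.ofBijective
    (fun j => ⟨(jordan j).iso, jordan j, cyclic_pow_indecomposable j.1.2.2 j.2, rfl⟩) (by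
    constructor
    · intro i j h
      exact linearIndependent_jordan.injective (congrArg (fun c => c.1.cls) h)
    · rintro ⟨_, V, hV, rfl⟩
      obtain ⟨j, hj⟩ := hV.exists_jordan
      exact ⟨j, Subtype.ext hj⟩)

theorem exists_basis_indecClass (k : Type u) [Field k] :
    ∃ β : Module.Basis (IndecClass k) ℤ (RepRing k), ∀ c : IndecClass k, β c = c.1.cls := by
  refine ⟨(jordanBasis k).reindex (jordanEquiv k), fun c => ?_⟩
  obtain ⟨j, rfl⟩ := (jordanEquiv k).surjective c
  rw [Module.Basis.reindex_apply, Equiv.symm_apply_apply, jordanBasis_apply]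
  rfl

/-! ### The subrings and the ideal -/

theorem kills_ofOp_iff {V : Type u} [AddCommGroup V] [Module k V] [Module.Finite k V]
    (a : Module.End k V) (g : k[X]) : (FDMod.ofOp a).Kills g ↔ Polynomial.aeval a g = 0 := by
  constructor
  · intro h
    ext v
    refine (Module.AEval'.of a).injective ?_
    rw [LinearMap.zero_apply, map_zero]
    exact (Module.AEval.of_aeval_smul (a := a) g v).trans (h _)
  · intro h v
    obtain ⟨v, rfl⟩ := (Module.AEval'.of a).surjective v
    refine (Module.AEval.of_aeval_smul (a := a) g v).symm.trans ?_
    rw [h, zero_smul, map_zero]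
    rfl

theorem kills_tensor_iff (V W : FDMod k) (g : k[X]) : (V.tensor W).Kills g ↔
    Polynomial.aeval (TensorProduct.map (xOp (k := k) V.carrier) (xOp (k := k) W.carrier)) g
      = 0 :=
  kills_ofOp_iff _ g

theorem map_eq_mul {V W : Type u} [AddCommGroup V] [Module k V] [AddCommGroup W] [Module k W]
    (a : Module.End k V) (b : Module.End k W) : TensorProduct.map a b =
      Module.End.rTensorAlgHom k V W a * Module.End.lTensorAlgHom k W V b :=
  TensorProduct.ext' fun _ _ => rfl

theorem commute_rTensor_lTensor {V W : Type u} [AddCommGroup V] [Module k V] [AddCommGroup W]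
    [Module k W] (a : Module.End k V) (b : Module.End k W) :
    Commute (Module.End.rTensorAlgHom k V W a) (Module.End.lTensorAlgHom k W V b) :=
  TensorProduct.ext' fun _ _ => rfl

theorem isUnit_xOp {V : FDMod k} {g : k[X]} (hV : V.Kills g) (hg : IsCoprime Polynomial.X g) :
    IsUnit (xOp (k := k) V.carrier) := by
  obtain ⟨a, b, hab⟩ := hg
  have h1 := congrArg (Polynomial.aeval (xOp (k := k) V.carrier)) hab
  rw [map_add, map_mul, map_mul, (V.kills_iff g).1 hV, mul_zero, add_zero, map_one,
    Polynomial.aeval_X] at h1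
  have h2 : xOp (k := k) V.carrier * Polynomial.aeval (xOp (k := k) V.carrier) a = 1 := by
    have h3 := (Polynomial.commute_X a).map (Polynomial.aeval (xOp (k := k) V.carrier))
    rw [Polynomial.aeval_X] at h3
    rw [h3.eq, h1]
  exact ⟨⟨_, _, h2, h1⟩, rfl⟩

theorem isCoprime_X_of_eval_ne_zero {g : k[X]} (h : g.eval 0 ≠ 0) : IsCoprime Polynomial.X g := by
  refine (Polynomial.irreducible_X.coprime_iff_not_dvd).2 fun hd => h ?_
  rwa [Polynomial.X_dvd_iff, Polynomial.coeff_zero_eq_eval_zero] at hd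

theorem mul_mem_of_mem_closure {R : Type*} [Ring R] {S T : Set R} {U : AddSubgroup R}
    (h : ∀ s ∈ S, ∀ t ∈ T, s * t ∈ U) {x y : R} (hx : x ∈ AddSubgroup.closure S)
    (hy : y ∈ AddSubgroup.closure T) : x * y ∈ U := by
  induction hx using AddSubgroup.closure_induction with
  | mem s hs =>
    induction hy using AddSubgroup.closure_induction with
    | mem t ht => exact h s hs t ht
    | zero => simp [U.zero_mem]
    | add a b _ _ ha hb => rw [mul_add]; exact U.add_mem ha hb
    | neg a _ ha => rw [mul_neg]; exact U.neg_mem ha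
  | zero => simp [U.zero_mem]
  | add a b _ _ ha hb => rw [add_mul]; exact U.add_mem ha hb
  | neg a _ ha => rw [neg_mul]; exact U.neg_mem ha

theorem cls_unit : (FDMod.unit k).cls = 1 :=
  map_one (Ideal.Quotient.mk _)

theorem unit_kills : (FDMod.unit k).Kills (Polynomial.X - 1) :=
  (kills_ofOp_iff _ _).2 (by
    rw [map_sub, Polynomial.aeval_X, map_one]
    exact sub_self _)

theorem irreducible_X_sub_one : Irreducible (Polynomial.X - 1 : k[X]) :=
  Polynomial.irreducible_X_sub_C (1 : k)

theorem associated_of_pow_succ_dvd_pow {f g : k[X]} (hf : Irreducible f) (hg : Irreducible g)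
    {s n : ℕ} (h : f ^ (s + 1) ∣ g ^ n) : Associated f g :=
  hf.associated_of_dvd hg
    (hf.prime.dvd_of_dvd_pow ((dvd_pow_self f s.succ_ne_zero).trans h))

/-- If `x - 1` acts nilpotently on a module, then its class belongs to `R'`. -/
theorem cls_mem_unipotentSpan {V : FDMod k} {n : ℕ} (hV : V.Kills ((Polynomial.X - 1) ^ n)) :
    V.cls ∈ unipotentSpan k := by
  refine V.cls_mem_of_kills hV _ fun f s hf hd => AddSubgroup.subset_closure
    ⟨s + 1, by omega, cyclic_cls_congr ?_ _ _⟩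
  exact (associated_of_pow_succ_dvd_pow hf irreducible_X_sub_one hd).pow_pow

/-- If `x` acts nilpotently on a module, then its class belongs to `I`. -/
theorem cls_mem_nilpotentSpan {V : FDMod k} {n : ℕ} (hV : V.Kills (Polynomial.X ^ n)) :
    V.cls ∈ nilpotentSpan k := by
  refine V.cls_mem_of_kills hV _ fun f s hf hd => AddSubgroup.subset_closure
    ⟨s + 1, by omega, cyclic_cls_congr ?_ _ _⟩
  exact (associated_of_pow_succ_dvd_pow hf Polynomial.irreducible_X hd).pow_pow

/-- If `x` acts on a module as a semisimple bijection, then its class belongs to `R̄`. -/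
theorem cls_mem_simpleSpan {V : FDMod k} {g : k[X]} (hV : V.Kills g) (hg : Squarefree g)
    (h0 : g.eval 0 ≠ 0) : V.cls ∈ simpleSpan k := by
  refine V.cls_mem_of_kills hV _ fun f s hf hd => AddSubgroup.subset_closure ⟨f, hf, ?_, ?_⟩
  · intro h
    obtain ⟨q, hq⟩ := (dvd_pow_self f s.succ_ne_zero).trans hd
    exact h0 (by rw [hq, Polynomial.eval_mul, h, zero_mul])
  · have hs : s = 0 := by
      by_contra hs
      refine hf.not_isUnit (hg f (dvd_trans ?_ hd))
      rw [← pow_two]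
      exact pow_dvd_pow _ (by omega)
    subst hs
    exact cyclic_cls_congr (by rw [zero_add, pow_one]) _ _

theorem isNilpotent_xOp_sub_one {V : FDMod k} {n : ℕ} (hV : V.Kills ((Polynomial.X - 1) ^ n)) :
    IsNilpotent (xOp (k := k) V.carrier - 1) :=
  ⟨n, by simpa using (V.kills_iff _).1 hV⟩

theorem tensor_kills_sub_one_pow {V W : FDMod k} {m n : ℕ}
    (hV : V.Kills ((Polynomial.X - 1) ^ m)) (hW : W.Kills ((Polynomial.X - 1) ^ n)) :
    ∃ l, (V.tensor W).Kills ((Polynomial.X - 1) ^ l) := by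
  have hc := commute_rTensor_lTensor (xOp (k := k) V.carrier) (xOp (k := k) W.carrier)
  have hA := (isNilpotent_xOp_sub_one hV).map (Module.End.rTensorAlgHom k V.carrier W.carrier)
  have hB := (isNilpotent_xOp_sub_one hW).map (Module.End.lTensorAlgHom k W.carrier V.carrier)
  have hAB := map_eq_mul (xOp (k := k) V.carrier) (xOp (k := k) W.carrier)
  rw [map_sub, map_one] at hA hB
  set A := Module.End.rTensorAlgHom k V.carrier W.carrier (xOp (k := k) V.carrier)
  set B := Module.End.lTensorAlgHom k W.carrier V.carrier (xOp (k := k) W.carrier)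
  have hcA : Commute (A - 1) B := hc.sub_left (Commute.one_left _)
  have h : IsNilpotent (A * B - 1) := by
    have h1 : A * B - 1 = (A - 1) * B + (B - 1) := by rw [sub_mul, one_mul]; abel
    rw [h1]
    refine Commute.isNilpotent_add (Commute.mul_left ?_ ?_) (hcA.isNilpotent_mul_right hA) hB
    · exact hcA.sub_right (Commute.one_right _)
    · exact (Commute.refl B).sub_right (Commute.one_right _)
  obtain ⟨l, hl⟩ := h
  refine ⟨l, (kills_tensor_iff V W _).2 ?_⟩
  rw [hAB, map_pow, map_sub, Polynomial.aeval_X, map_one, hl]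

/-- The tensor product of two modules on which `x` acts as a semisimple bijection is of the same
kind, because over a perfect field products of commuting semisimple operators are semisimple. -/
theorem cls_tensor_mem_simpleSpan [PerfectField k] {V W : FDMod k} {f g : k[X]} (hV : V.Kills f)
    (hW : W.Kills g) (hf : Squarefree f) (hg : Squarefree g) (hf0 : f.eval 0 ≠ 0)
    (hg0 : g.eval 0 ≠ 0) : (V.tensor W).cls ∈ simpleSpan k := by
  have hc := commute_rTensor_lTensor (xOp (k := k) V.carrier) (xOp (k := k) W.carrier)
  have hAB := map_eq_mul (xOp (k := k) V.carrier) (xOp (k := k) W.carrier)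
  have hA : (Module.End.rTensorAlgHom k V.carrier W.carrier
      (xOp (k := k) V.carrier)).IsSemisimple :=
    Module.End.isSemisimple_of_squarefree_aeval_eq_zero hf (by
      rw [Polynomial.aeval_algHom_apply, (V.kills_iff f).1 hV, map_zero])
  have hB : (Module.End.lTensorAlgHom k W.carrier V.carrier
      (xOp (k := k) W.carrier)).IsSemisimple :=
    Module.End.isSemisimple_of_squarefree_aeval_eq_zero hg (by
      rw [Polynomial.aeval_algHom_apply, (W.kills_iff g).1 hW, map_zero])
  have hu : IsUnit (TensorProduct.map (xOp (k := k) V.carrier) (xOp (k := k) W.carrier) :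
      Module.End k (V.carrier ⊗[k] W.carrier)) := by
    rw [hAB]
    exact ((isUnit_xOp hV (isCoprime_X_of_eval_ne_zero hf0)).map _).mul
      ((isUnit_xOp hW (isCoprime_X_of_eval_ne_zero hg0)).map _)
  have hss := Module.End.IsSemisimple.mul_of_commute hc hA hB
  rw [← hAB] at hss
  refine cls_mem_simpleSpan ((kills_tensor_iff V W _).2 (minpoly.aeval k _))
    hss.minpoly_squarefree fun h => ?_
  obtain ⟨v, hv⟩ := (Module.End.hasEigenvalue_of_isRoot h).exists_hasEigenvector
  refine hv.2 (((Module.End.isUnit_iff _).1 hu).injective ?_)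
  rw [hv.apply_eq_smul, zero_smul, map_zero]

/-- The subring `R'`. -/
def unipotentSubring (k : Type u) [Field k] : Subring (RepRing k) where
  __ := unipotentSpan k
  one_mem' := by
    rw [← cls_unit]
    exact cls_mem_unipotentSpan (n := 1) (by rw [pow_one]; exact unit_kills)
  mul_mem' := by
    refine mul_mem_of_mem_closure ?_
    rintro _ ⟨s, -, rfl⟩ _ ⟨t, -, rfl⟩
    rw [← FDMod.cls_tensor]
    obtain ⟨l, hl⟩ := tensor_kills_sub_one_pow (FDMod.cyclic_kills
      ((Polynomial.X - 1 : k[X]) ^ s) (pow_ne_zero s (Polynomial.X_sub_C_ne_zero 1)))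
      (FDMod.cyclic_kills
        ((Polynomial.X - 1 : k[X]) ^ t) (pow_ne_zero t (Polynomial.X_sub_C_ne_zero 1)))
    exact cls_mem_unipotentSpan hl

/-- The subring `R̄`. -/
def simpleSubring (k : Type u) [Field k] [PerfectField k] : Subring (RepRing k) where
  __ := simpleSpan k
  one_mem' := by
    rw [← cls_unit]
    exact cls_mem_simpleSpan (k := k) unit_kills irreducible_X_sub_one.squarefree (by simp)
  mul_mem' := by
    refine mul_mem_of_mem_closure ?_
    rintro _ ⟨f, hf, hf0, rfl⟩ _ ⟨g, hg, hg0, rfl⟩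
    rw [← FDMod.cls_tensor]
    exact cls_tensor_mem_simpleSpan (FDMod.cyclic_kills _ _)
      (FDMod.cyclic_kills _ _) hf.squarefree hg.squarefree hf0 hg0

theorem tensor_kills_X_pow (V : FDMod k) {W : FDMod k} {n : ℕ}
    (hW : W.Kills (Polynomial.X ^ n)) : (V.tensor W).Kills (Polynomial.X ^ n) := by
  have h := (W.kills_iff _).1 hW
  rw [map_pow, Polynomial.aeval_X] at h
  rw [kills_tensor_iff, map_pow, Polynomial.aeval_X, TensorProduct.map_pow, h,
    TensorProduct.map_zero_right]

/-- The ideal `I`. -/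
def nilpotentIdeal (k : Type u) [Field k] : Ideal (RepRing k) where
  __ := nilpotentSpan k
  smul_mem' := by
    intro r w hw
    have hr : r ∈ AddSubgroup.closure (Set.range (FDMod.cls (k := k))) :=
      RepRing.mem_of_cls_mem _ (fun V => AddSubgroup.subset_closure (Set.mem_range_self V)) r
    refine mul_mem_of_mem_closure (U := nilpotentSpan k) ?_ hr hw
    rintro _ ⟨V, rfl⟩ _ ⟨s, -, rfl⟩
    rw [← FDMod.cls_tensor]
    exact cls_mem_nilpotentSpan
      (tensor_kills_X_pow V (FDMod.cyclic_kills _ _))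

/-! ### Two tensor product formulas -/

/-- Let `ν` shift the sequence `e`, whose first terms are a basis of `N` and whose other terms
vanish. For a bijection `a`, the map `v ⊗ e j ↦ a ^ j v ⊗ e j` conjugates `1 ⊗ ν` to `a ⊗ ν`. -/
theorem exists_conj_tensor_shift {V N : Type u} [AddCommGroup V] [Module k V] [AddCommGroup N]
    [Module k N] {a : Module.End k V} (ha : IsUnit a) {s : ℕ} (b : Module.Basis (Fin s) k N)
    (e : ℕ → N) (hb : ∀ i, b i = e i) (he : ∀ j, s ≤ j → e j = 0) (ν : Module.End k N)
    (hν : ∀ j, ν (e j) = e (j + 1)) :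
    ∃ Φ : V ⊗[k] N ≃ₗ[k] V ⊗[k] N, ∀ t, Φ (TensorProduct.map 1 ν t) =
      TensorProduct.map a ν (Φ t) := by
  -- `T u` is the map `v ⊗ e j ↦ u ^ j v ⊗ e j`
  let T : Module.End k V → (V ⊗[k] N →ₗ[k] V ⊗[k] N) := fun u =>
    TensorProduct.lift
      (b.constr k fun i => ((TensorProduct.mk k V N).flip (e i)).comp (u ^ (i : ℕ))).flip
  have hT : ∀ u v j, T u (v ⊗ₜ e j) = (u ^ j) v ⊗ₜ e j := by
    intro u v j
    rcases lt_or_ge j s with hj | hj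
    · have h : e j = b ⟨j, hj⟩ := (hb ⟨j, hj⟩).symm
      change (b.constr k _ (e j) : V →ₗ[k] V ⊗[k] N) v = _
      rw [h, Module.Basis.constr_basis, ← h]
      rfl
    · rw [he j hj, TensorProduct.tmul_zero, TensorProduct.tmul_zero, map_zero]
  have hext : ∀ f g : V ⊗[k] N →ₗ[k] V ⊗[k] N,
      (∀ v (j : ℕ), f (v ⊗ₜ e j) = g (v ⊗ₜ e j)) → f = g := fun f g h =>
    TensorProduct.ext (LinearMap.ext fun v => b.ext fun i => by
      rw [hb]
      exact h v i)
  have hinv : ∀ u w : Module.End k V, u * w = 1 → Commute u w → T u ∘ₗ T w = LinearMap.id :=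
    fun u w h hc => hext _ _ fun v j => by
      rw [LinearMap.comp_apply, hT, hT, ← Module.End.mul_apply, ← hc.mul_pow, h, one_pow]
      rfl
  obtain ⟨a, rfl⟩ := ha
  have hc : Commute (a : Module.End k V) (a⁻¹ : (Module.End k V)ˣ) := by
    rw [commute_iff_eq, a.mul_inv, a.inv_mul]
  refine ⟨LinearEquiv.ofLinearMap (T a) (T (a⁻¹ : (Module.End k V)ˣ)) (hinv _ _ a.mul_inv hc)
    (hinv _ _ a.inv_mul hc.symm), fun t => ?_⟩
  refine LinearMap.congr_fun (hext ((T a).comp (TensorProduct.map 1 ν))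
    ((TensorProduct.map (a : Module.End k V) ν).comp (T a)) fun v j => ?_) t
  rw [LinearMap.comp_apply, LinearMap.comp_apply, TensorProduct.map_tmul, hν, hT, hT,
    TensorProduct.map_tmul, hν, pow_succ', Module.End.mul_apply, Module.End.one_apply]

theorem exists_basis_cyclic_X_pow (s : ℕ) (hX : (Polynomial.X ^ s : k[X]) ≠ 0) :
    ∃ b : Module.Basis (Fin s) k (FDMod.cyclic (Polynomial.X ^ s) hX).carrier,
      ∀ i : Fin s, b i = cyclicMk _ hX (Polynomial.X ^ (i : ℕ)) := by
  have hdim : (AdjoinRoot.powerBasis hX).dim = s := by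
    rw [AdjoinRoot.powerBasis_dim, Polynomial.natDegree_X_pow]
  let b : Module.Basis (Fin s) k (AdjoinRoot (Polynomial.X ^ s : k[X])) :=
    (AdjoinRoot.powerBasis hX).basis.reindex (finCongr hdim)
  let b' : Module.Basis (Fin s) k (FDMod.cyclic (Polynomial.X ^ s) hX).carrier := b
  refine ⟨b', fun i => ?_⟩
  refine (Module.Basis.reindex_apply (AdjoinRoot.powerBasis hX).basis (finCongr hdim) _).trans
    (((AdjoinRoot.powerBasis hX).basis_eq_pow _).trans ?_)
  rw [AdjoinRoot.powerBasis_gen]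
  exact (map_pow (AdjoinRoot.mk (Polynomial.X ^ s)) Polynomial.X _).symm

theorem finrank_cyclic (f : k[X]) (hf : f ≠ 0) :
    Module.finrank k (FDMod.cyclic f hf).carrier = f.natDegree :=
  finrank_quotient_span_eq_natDegree

/-- If `x` acts bijectively on `V`, then `V ⊗ k[x]/(x ^ s)` does not depend, up to isomorphism, on
the operator `x` on `V`. -/
theorem tensor_cyclic_X_pow (V : FDMod k) (hV : IsUnit (xOp (k := k) V.carrier)) (s : ℕ) :
    ((FDMod.ofOp (1 : Module.End k V.carrier)).tensor
      (FDMod.cyclic (Polynomial.X ^ s) (pow_ne_zero s Polynomial.X_ne_zero))).iso =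
    (V.tensor (FDMod.cyclic (Polynomial.X ^ s) (pow_ne_zero s Polynomial.X_ne_zero))).iso := by
  have hX : (Polynomial.X ^ s : k[X]) ≠ 0 := pow_ne_zero s Polynomial.X_ne_zero
  obtain ⟨b, hb⟩ := exists_basis_cyclic_X_pow s hX
  let N := FDMod.cyclic (Polynomial.X ^ s) hX
  obtain ⟨Φ, hΦ⟩ := exists_conj_tensor_shift hV b (fun j => cyclicMk _ hX (Polynomial.X ^ j)) hb
    (fun j hj => cyclicMk_eq_zero_iff.2 (pow_dvd_pow _ hj)) (xOp (k := k) N.carrier)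
    (fun j => (smul_cyclicMk _ _).trans (by rw [← pow_succ']))
  let τ : V.carrier ≃ₗ[k] (FDMod.ofOp (1 : Module.End k V.carrier)).carrier :=
    Module.AEval'.of (1 : Module.End k V.carrier)
  have hτ : ∀ v, (Polynomial.X : k[X]) • τ v = τ v := fun v => Module.AEval'.X_smul_of _ _
  refine iso_tensor_of_tmul (((TensorProduct.congr τ.symm (LinearEquiv.refl k N.carrier)).trans
    Φ).trans (tensorEquiv V N)) fun v n => ?_
  obtain ⟨v, rfl⟩ := τ.surjective v
  simp only [hτ, LinearEquiv.trans_apply, TensorProduct.congr_tmul, LinearEquiv.symm_apply_apply,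
    LinearEquiv.refl_apply, X_smul_tensorEquiv, ← hΦ, TensorProduct.map_tmul,
    Module.End.one_apply]
  rfl

/-- A module on which `x - 1` acts as zero is a sum of copies of the trivial module. -/
theorem cls_of_kills_X_sub_one {V : FDMod k} (hV : V.Kills (Polynomial.X - 1)) :
    V.cls = (Module.finrank k V.carrier : ℤ) • (1 : RepRing k) := by
  have hne : (Polynomial.X - 1 : k[X]) ≠ 0 := irreducible_X_sub_one.ne_zero
  -- the multiples of `c = [k[x]/(x - 1)]` are told apart by their dimension, as `dim c = 1`
  set c := (FDMod.cyclic (Polynomial.X - 1 : k[X]) hne).cls with hc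
  have key : ∀ W : FDMod k, W.Kills (Polynomial.X - 1) → ∃ m : ℤ, m • c = W.cls := by
    intro W hW
    refine AddSubgroup.mem_zmultiples_iff.1 (W.cls_mem_of_kills hW _ fun f s hf hd => ?_)
    have hs : s = 0 := by
      by_contra hs
      refine hf.not_isUnit (irreducible_X_sub_one.squarefree f (dvd_trans ?_ hd))
      rw [← pow_two]
      exact pow_dvd_pow _ (by omega)
    subst hs
    rw [cyclic_cls_congr (g := Polynomial.X - 1) _ _ hne]
    · exact AddSubgroup.mem_zmultiples _
    · rw [zero_add, pow_one] at hd ⊢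
      exact hf.associated_of_dvd irreducible_X_sub_one hd
  have hdim : dim k c = 1 := by
    rw [hc, dim_cls, finrank_cyclic]
    exact congrArg Nat.cast (Polynomial.natDegree_X_sub_C (1 : k))
  have h : ∀ W : FDMod k, W.Kills (Polynomial.X - 1) →
      W.cls = (Module.finrank k W.carrier : ℤ) • c := by
    intro W hW
    obtain ⟨m, hm⟩ := key W hW
    have h1 := congrArg (dim k) hm
    rw [map_zsmul, hdim, dim_cls, smul_eq_mul, mul_one] at h1
    rw [← hm, h1]
  have h1 := h _ unit_kills
  rw [cls_unit, ← (unitEquiv k).finrank_eq, Module.finrank_self, Nat.cast_one, one_smul] at h1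
  rw [h V hV, h1]

/-- If `x` acts bijectively on `V`, then `V ⊗ N` is a sum of `dim V` copies of `N`, for
`N = k[x]/(x ^ s)`. -/
theorem cls_mul_cyclic_X_pow (V : FDMod k) (hV : IsUnit (xOp (k := k) V.carrier)) (s : ℕ) :
    V.cls * (FDMod.cyclic (Polynomial.X ^ s) (pow_ne_zero s Polynomial.X_ne_zero)).cls =
      (Module.finrank k V.carrier : ℤ) •
        (FDMod.cyclic (Polynomial.X ^ s) (pow_ne_zero s (Polynomial.X_ne_zero (R := k)))).cls := by
  have h1 : (FDMod.ofOp (1 : Module.End k V.carrier)).Kills (Polynomial.X - 1) :=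
    (kills_ofOp_iff _ _).2 (by rw [map_sub, Polynomial.aeval_X, map_one, sub_self])
  have h2 := cls_of_kills_X_sub_one h1
  have h3 : Module.finrank k (FDMod.ofOp (1 : Module.End k V.carrier)).carrier =
      Module.finrank k V.carrier := (Module.AEval'.of (1 : Module.End k V.carrier)).finrank_eq.symm
  have h4 := congrArg IsoClass.cls (tensor_cyclic_X_pow V hV s)
  change FDMod.cls _ = FDMod.cls _ at h4
  rw [FDMod.cls_tensor, FDMod.cls_tensor, h2, h3, smul_mul_assoc, one_mul] at h4
  exact h4.symm

/-- Let `α` be a root of the separable polynomial `f`, where `f(0) ≠ 0`, and let `n` be nilpotent.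
The values at `α` of `x` and of the derivative of `f` are units, as both polynomials are coprime to
`f`. Hence, by Taylor expansion at `α`, `f((1 + n) α)` is the product of `n` and a unit. -/
theorem exists_isUnit_aeval_eq {A : Type u} [CommRing A] [Algebra k A] {f : k[X]}
    (hf : f.Separable) (hf0 : f.eval 0 ≠ 0) {n α : A} (hn : IsNilpotent n)
    (hα : Polynomial.aeval α f = 0) :
    ∃ c, IsUnit c ∧ Polynomial.aeval ((1 + n) * α) f = c * n := by
  obtain ⟨a, b, hab⟩ := hf
  have hder : IsUnit (Polynomial.aeval α (Polynomial.derivative f)) := by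
    have h := congrArg (Polynomial.aeval α) hab
    rw [map_add, map_mul, map_mul, hα, mul_zero, zero_add, map_one] at h
    exact IsUnit.of_mul_eq_one_right _ h
  have hαu : IsUnit α := by
    obtain ⟨a, b, hab⟩ := isCoprime_X_of_eval_ne_zero hf0
    have h := congrArg (Polynomial.aeval α) hab
    rw [map_add, map_mul, map_mul, hα, mul_zero, add_zero, map_one, Polynomial.aeval_X] at h
    exact IsUnit.of_mul_eq_one_right _ h
  obtain ⟨z, hz⟩ := (f.map (algebraMap k A)).binomExpansion α (n * α)
  rw [Polynomial.derivative_map, Polynomial.eval_map_algebraMap, Polynomial.eval_map_algebraMap,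
    Polynomial.eval_map_algebraMap, hα] at hz
  refine ⟨Polynomial.aeval α (Polynomial.derivative f) * α + n * (z * α ^ 2), ?_, ?_⟩
  · exact IsNilpotent.isUnit_add_left_of_commute ((Commute.all _ _).isNilpotent_mul_right hn)
      (hder.mul hαu) (Commute.all _ _)
  · have h : (1 + n) * α = α + n * α := by ring
    rw [h, hz]
    ring

/-- Let `A` be a `k`-algebra of the same dimension as `k[x]/(f ^ (s + 1))`, and `t` an element
with `f(t) ^ (s + 1) = 0` and `f(t) ^ s ≠ 0`. Then multiplication by `t` makes `A` into a module
isomorphic to `k[x]/(f ^ (s + 1))`. -/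
theorem exists_equiv_cyclic {A : Type u} [CommRing A] [Algebra k A] [Module.Finite k A]
    {f : k[X]} (hf : Irreducible f) {s : ℕ} {t : A} (h0 : Polynomial.aeval t f ^ (s + 1) = 0)
    (h1 : Polynomial.aeval t f ^ s ≠ 0) (hA : Module.finrank k A = (s + 1) * f.natDegree) :
    ∃ e : A ≃ₗ[k] (k[X] ⧸ Ideal.span {f ^ (s + 1)}), ∀ z, e (t * z) =
      Ideal.Quotient.mk (Ideal.span {f ^ (s + 1)}) Polynomial.X * e z := by
  -- the minimal polynomial of `t` divides `f ^ (s + 1)` but not `f ^ s`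
  have hker : ∀ p, Polynomial.aeval t p = 0 ↔ f ^ (s + 1) ∣ p := by
    intro p
    have hd : minpoly k t ∣ f ^ (s + 1) := minpoly.dvd k t (by rw [map_pow, h0])
    obtain ⟨i, hi, hass⟩ := (dvd_prime_pow hf.prime _).1 hd
    have hi' : i = s + 1 := by
      by_contra hne
      refine h1 ?_
      rw [← map_pow, ← minpoly.dvd_iff]
      exact hass.dvd.trans (pow_dvd_pow f (by omega))
    rw [← minpoly.dvd_iff, ← hi']
    exact hass.dvd_iff_dvd_left
  let ψ : (k[X] ⧸ Ideal.span {f ^ (s + 1)}) →ₐ[k] A :=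
    Ideal.Quotient.liftₐ _ (Polynomial.aeval t) fun p hp =>
      (hker p).2 (Ideal.mem_span_singleton.1 hp)
  have hψ : ∀ p, ψ (Ideal.Quotient.mk _ p) = Polynomial.aeval t p := fun p => rfl
  have hinj : Function.Injective ψ := by
    refine (injective_iff_map_eq_zero ψ).2 fun q hq => ?_
    obtain ⟨p, rfl⟩ := Ideal.Quotient.mk_surjective q
    rw [hψ, hker] at hq
    exact Ideal.Quotient.eq_zero_iff_mem.2 (Ideal.mem_span_singleton.2 hq)
  have hfin : Module.Finite k (k[X] ⧸ Ideal.span {f ^ (s + 1)}) :=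
    (AdjoinRoot.powerBasis (pow_ne_zero (s + 1) hf.ne_zero)).finite
  let e := LinearMap.linearEquivOfInjective ψ.toLinearMap hinj (by
    rw [finrank_quotient_span_eq_natDegree, hA, Polynomial.natDegree_pow])
  refine ⟨e.symm, fun z => ?_⟩
  obtain ⟨q, rfl⟩ := e.surjective z
  rw [LinearEquiv.symm_apply_eq, LinearEquiv.symm_apply_apply]
  change t * ψ q = ψ (_ * q)
  rw [map_mul, hψ, Polynomial.aeval_X]

/-- If `β - 1` is nilpotent of order `s + 1` and `γ` is a root of `f`, then `f(β ⊗ γ)` is a unit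
times `(β - 1) ⊗ 1`, so that `B ⊗ L` is `k[x]/(f ^ (s + 1))` with `x` acting as `β ⊗ γ`. -/
theorem exists_equiv_tensor_cyclic {B L : Type u} [CommRing B] [Algebra k B] [Module.Finite k B]
    [CommRing L] [Algebra k L] [Module.Finite k L] [Nontrivial L] {f : k[X]} (hf : Irreducible f)
    (hs : f.Separable) (hf0 : f.eval 0 ≠ 0) {s : ℕ} {β : B} {γ : L} (h0 : (β - 1) ^ (s + 1) = 0)
    (h1 : (β - 1) ^ s ≠ 0) (hγ : Polynomial.aeval γ f = 0) (hB : Module.finrank k B = s + 1)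
    (hL : Module.finrank k L = f.natDegree) :
    ∃ e : B ⊗[k] L ≃ₗ[k] (k[X] ⧸ Ideal.span {f ^ (s + 1)}), ∀ z, e (β ⊗ₜ γ * z) =
      Ideal.Quotient.mk (Ideal.span {f ^ (s + 1)}) Polynomial.X * e z := by
  let n : B ⊗[k] L := (β - 1) ⊗ₜ 1
  let α : B ⊗[k] L := 1 ⊗ₜ γ
  have hn : ∀ m, n ^ m = ((β - 1) ^ m) ⊗ₜ[k] 1 := fun m => by
    rw [Algebra.TensorProduct.tmul_pow, one_pow]
  have hn0 : n ^ (s + 1) = 0 := by rw [hn, h0, TensorProduct.zero_tmul]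
  have hn1 : n ^ s ≠ 0 := by
    rw [hn]
    exact fun h => h1 (Algebra.TensorProduct.includeLeft_injective (S := k) (A := B)
      (algebraMap k L).injective (h.trans (TensorProduct.zero_tmul _ _).symm))
  have hα : Polynomial.aeval α f = 0 := by
    have h2 : α = Algebra.TensorProduct.includeRight (R := k) (A := B) γ := rfl
    rw [h2, Polynomial.aeval_algHom_apply, hγ, map_zero]
  obtain ⟨c, hc, hfc⟩ := exists_isUnit_aeval_eq hs hf0 ⟨_, hn0⟩ hα
  have ht : (1 + n) * α = β ⊗ₜ γ := by
    have h2 : (1 : B ⊗[k] L) + n = β ⊗ₜ 1 := by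
      rw [Algebra.TensorProduct.one_def, ← TensorProduct.add_tmul, add_sub_cancel]
    rw [h2, Algebra.TensorProduct.tmul_mul_tmul, mul_one, one_mul]
  rw [ht] at hfc
  refine exists_equiv_cyclic hf ?_ ?_ ?_
  · rw [hfc, mul_pow, hn0, mul_zero]
  · rw [hfc, mul_pow]
    exact fun h => hn1 ((hc.pow s).mul_right_eq_zero.1 h)
  · rw [Module.finrank_tensorProduct, hB, hL]

/-- Over a perfect field, `k[x]/((x - 1) ^ (s + 1)) ⊗ k[x]/(f) ≅ k[x]/(f ^ (s + 1))` for an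
irreducible polynomial `f` with `f(0) ≠ 0`. -/
theorem cls_unipotent_mul_simple [PerfectField k] {f : k[X]} (hf : Irreducible f)
    (hf0 : f.eval 0 ≠ 0) (s : ℕ) :
    (FDMod.cyclic ((Polynomial.X - 1 : k[X]) ^ (s + 1))
      (pow_ne_zero _ (Polynomial.X_sub_C_ne_zero 1))).cls * (FDMod.cyclic f hf.ne_zero).cls =
      (FDMod.cyclic (f ^ (s + 1)) (pow_ne_zero _ hf.ne_zero)).cls := by
  have hX : (Polynomial.X - 1 : k[X]) ^ (s + 1) ≠ 0 :=
    pow_ne_zero _ (Polynomial.X_sub_C_ne_zero 1)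
  have hB : Module.Finite k (k[X] ⧸ Ideal.span {(Polynomial.X - 1 : k[X]) ^ (s + 1)}) :=
    (AdjoinRoot.powerBasis hX).finite
  have hL : Module.Finite k (k[X] ⧸ Ideal.span {f}) := (AdjoinRoot.powerBasis hf.ne_zero).finite
  have hLn : Nontrivial (k[X] ⧸ Ideal.span {f}) := Ideal.Quotient.nontrivial_iff.2 (by
    rw [Ne, Ideal.span_singleton_eq_top]
    exact hf.not_isUnit)
  have hpow : ∀ m, (Ideal.Quotient.mk (Ideal.span {(Polynomial.X - 1 : k[X]) ^ (s + 1)})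
      Polynomial.X - 1) ^ m = Ideal.Quotient.mk _ ((Polynomial.X - 1) ^ m) := fun m => by
    rw [map_pow, map_sub, map_one]
  have hγ : Polynomial.aeval (Ideal.Quotient.mk (Ideal.span {f}) Polynomial.X) f = 0 := by
    have h1 : Ideal.Quotient.mk (Ideal.span {f}) Polynomial.X
        = Ideal.Quotient.mkₐ k (Ideal.span {f}) Polynomial.X := rfl
    rw [h1, Polynomial.aeval_algHom_apply, Polynomial.aeval_X_left_apply]
    exact Ideal.Quotient.eq_zero_iff_mem.2 (Ideal.mem_span_singleton_self _)
  obtain ⟨e, he⟩ := exists_equiv_tensor_cyclic (s := s) hf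
    (PerfectField.separable_of_irreducible hf) hf0
    (by rw [hpow]; exact Ideal.Quotient.eq_zero_iff_mem.2 (Ideal.mem_span_singleton_self _))
    (by
      rw [hpow, Ne, Ideal.Quotient.eq_zero_iff_mem, Ideal.mem_span_singleton,
        pow_dvd_pow_iff irreducible_X_sub_one.ne_zero irreducible_X_sub_one.not_isUnit]
      omega)
    hγ
    (by
      rw [finrank_quotient_span_eq_natDegree, Polynomial.natDegree_pow, ← Polynomial.C_1,
        Polynomial.natDegree_X_sub_C, mul_one])
    finrank_quotient_span_eq_natDegree
  rw [← FDMod.cls_tensor]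
  refine congrArg IsoClass.cls (iso_tensor_of_tmul
    (V := FDMod.cyclic ((Polynomial.X - 1 : k[X]) ^ (s + 1)) hX)
    (W := FDMod.cyclic f hf.ne_zero)
    (U := FDMod.cyclic (f ^ (s + 1)) (pow_ne_zero _ hf.ne_zero)) e fun v w => ?_)
  obtain ⟨p, rfl⟩ := Ideal.Quotient.mk_surjective v
  obtain ⟨q, rfl⟩ := Ideal.Quotient.mk_surjective w
  have h := he (Ideal.Quotient.mk _ p ⊗ₜ Ideal.Quotient.mk _ q)
  rw [Algebra.TensorProduct.tmul_mul_tmul] at h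
  exact h.trans (Algebra.smul_def (Polynomial.X : k[X]) (e _)).symm

/-! ### The isomorphism `R' ⊗ R̄ ⊕ I ≅ R` -/

/-- The class of `k[x]/((x - 1) ^ (s + 1))`, as an element of `R'`. -/
def unipotentCls (k : Type u) [Field k] (s : ℕ) : unipotentSubring k :=
  ⟨_, AddSubgroup.subset_closure ⟨s + 1, by omega, rfl⟩⟩

/-- The class of `k[x]/(f)`, as an element of `R̄`. -/
def simpleCls [PerfectField k] (f : k[X]) (hf : Irreducible f) (hf0 : f.eval 0 ≠ 0) :
    simpleSubring k :=
  ⟨_, AddSubgroup.subset_closure ⟨f, hf, hf0, rfl⟩⟩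

/-- The class of `k[x]/(x ^ (s + 1))`, as an element of `I`. -/
def nilpotentCls (k : Type u) [Field k] (s : ℕ) : nilpotentIdeal k :=
  ⟨_, AddSubgroup.subset_closure ⟨s + 1, by omega, rfl⟩⟩

/-- If `x` acts bijectively on the modules whose classes span a subgroup, then an element `a` of
this subgroup acts on `I` as the integer `dim a`. -/
theorem mul_eq_dim_smul {S : Set (RepRing k)}
    (hS : ∀ r ∈ S, ∃ V : FDMod k, IsUnit (xOp (k := k) V.carrier) ∧ r = V.cls)
    {a w : RepRing k} (ha : a ∈ AddSubgroup.closure S) (hw : w ∈ nilpotentSpan k) :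
    a * w = dim k a • w := by
  induction ha using AddSubgroup.closure_induction with
  | mem r hr =>
    obtain ⟨V, hV, rfl⟩ := hS r hr
    rw [dim_cls]
    induction hw using AddSubgroup.closure_induction with
    | mem _ hw =>
      obtain ⟨s, -, rfl⟩ := hw
      exact cls_mul_cyclic_X_pow V hV s
    | zero => simp
    | add x y _ _ hx hy => rw [mul_add, hx, hy, smul_add]
    | neg x _ hx => exact (mul_neg _ _).trans ((congrArg Neg.neg hx).trans (smul_neg _ _).symm)
  | zero => simp
  | add x y _ _ hx hy => rw [add_mul, hx, hy, map_add, add_smul]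
  | neg x _ hx =>
    exact (neg_mul _ _).trans ((congrArg Neg.neg hx).trans ((neg_smul _ _).symm.trans
      (congrArg (· • w) (map_neg (dim k) x).symm)))

theorem unipotentSpan_mul {a w : RepRing k} (ha : a ∈ unipotentSpan k)
    (hw : w ∈ nilpotentSpan k) : a * w = dim k a • w := by
  refine mul_eq_dim_smul ?_ ha hw
  rintro _ ⟨s, -, rfl⟩
  refine ⟨_, isUnit_xOp (FDMod.cyclic_kills _ _) ?_, rfl⟩
  exact (isCoprime_X_of_eval_ne_zero (by simp)).pow_right

theorem simpleSpan_mul {a w : RepRing k} (ha : a ∈ simpleSpan k)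
    (hw : w ∈ nilpotentSpan k) : a * w = dim k a • w := by
  refine mul_eq_dim_smul ?_ ha hw
  rintro _ ⟨f, hf, hf0, rfl⟩
  exact ⟨_, isUnit_xOp (FDMod.cyclic_kills _ _) (isCoprime_X_of_eval_ne_zero hf0), rfl⟩

theorem eval_zero_ne_zero {f : k[X]} (hf : Irreducible f) (hm : f.Monic)
    (h : f ≠ Polynomial.X) : f.eval 0 ≠ 0 := fun h0 =>
  h (Polynomial.eq_of_monic_of_associated Polynomial.monic_X hm
    (Polynomial.irreducible_X.associated_of_dvd hf (by
      rw [Polynomial.X_dvd_iff, Polynomial.coeff_zero_eq_eval_zero, h0]))).symm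

variable [PerfectField k]

/-- The ring morphism `R' ⊗ R̄ → R` given by multiplication. -/
def mulMap (k : Type u) [Field k] [PerfectField k] :
    unipotentSubring k ⊗[ℤ] simpleSubring k →+* RepRing k :=
  (Algebra.TensorProduct.productMap (unipotentSubring k).subtype.toIntAlgHom
    (simpleSubring k).subtype.toIntAlgHom).toRingHom

theorem mulMap_tmul (a : unipotentSubring k) (b : simpleSubring k) :
    mulMap k (a ⊗ₜ b) = (a : RepRing k) * b :=
  Algebra.TensorProduct.productMap_apply_tmul _ _ a b

theorem mulMap_mul (t : unipotentSubring k ⊗[ℤ] simpleSubring k) (w : nilpotentIdeal k) :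
    mulMap k t * (w : RepRing k) =
      (tensorDim (unipotentSubring k) (simpleSubring k) t : RepRing k) * w := by
  induction t with
  | zero => simp
  | add x y hx hy => rw [map_add, map_add, add_mul, hx, hy, Int.cast_add, add_mul]
  | tmul a b =>
    rw [mulMap_tmul, tensorDim_tmul, mul_assoc, simpleSpan_mul b.2 w.2, mul_smul_comm,
      unipotentSpan_mul a.2 w.2, smul_smul, zsmul_eq_mul, mul_comm (dim k (b : RepRing k))]

open Classical in
/-- The inverse of `(t, w) ↦ μ t + w`, where `μ` is the multiplication `R' ⊗ R̄ → R`. It takes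
`[k[x]/(f ^ s)]` to `[k[x]/((x - 1) ^ s)] ⊗ [k[x]/(f)]` if `f ≠ x`, and to itself if `f = x`. -/
def splitMap (k : Type u) [Field k] [PerfectField k] :
    RepRing k →ₗ[ℤ] (unipotentSubring k ⊗[ℤ] simpleSubring k) × nilpotentIdeal k :=
  (jordanBasis k).constr ℤ fun j =>
    if h : j.1.1 = Polynomial.X then (0, nilpotentCls k j.2)
    else (unipotentCls k j.2 ⊗ₜ simpleCls j.1.1 j.1.2.2 (eval_zero_ne_zero j.1.2.2 j.1.2.1 h), 0)

theorem splitMap_jordan_X (s : ℕ) :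
    splitMap k (jordan (⟨Polynomial.X, Polynomial.monic_X, Polynomial.irreducible_X⟩, s)).cls =
      (0, nilpotentCls k s) := by
  rw [← jordanBasis_apply, splitMap, Module.Basis.constr_basis, dif_pos rfl]

theorem splitMap_jordan {f : k[X]} (hf : f.Monic ∧ Irreducible f) (hf0 : f.eval 0 ≠ 0) (s : ℕ) :
    splitMap k (jordan (⟨f, hf⟩, s)).cls = (unipotentCls k s ⊗ₜ simpleCls f hf.2 hf0, 0) := by
  have h : f ≠ Polynomial.X := fun h => hf0 (by rw [h, Polynomial.eval_X])
  rw [← jordanBasis_apply, splitMap, Module.Basis.constr_basis, dif_neg h]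

theorem splitMap_nilpotent (w : nilpotentIdeal k) : splitMap k (w : RepRing k) = (0, w) := by
  obtain ⟨w, hw⟩ := w
  change splitMap k w = (0, ⟨w, hw⟩)
  have hw' : w ∈ nilpotentSpan k := hw
  -- membership in the subgroup is carried along the induction, as the claim depends on it
  suffices h : ∃ hw : w ∈ nilpotentIdeal k, splitMap k w = (0, ⟨w, hw⟩) from h.2
  induction hw' using AddSubgroup.closure_induction with
  | mem r hr =>
    obtain ⟨s, hs, rfl⟩ := hr
    obtain ⟨s, rfl⟩ := Nat.exists_eq_add_of_le' hs
    exact ⟨(nilpotentCls k s).2, splitMap_jordan_X s⟩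
  | zero => exact ⟨zero_mem _, map_zero _⟩
  | add x y hx hy ihx ihy =>
    obtain ⟨hx, ihx⟩ := ihx hx
    obtain ⟨hy, ihy⟩ := ihy hy
    exact ⟨add_mem hx hy, by rw [map_add, ihx, ihy, Prod.mk_add_mk, add_zero]; rfl⟩
  | neg x hx ihx =>
    obtain ⟨hx, ihx⟩ := ihx hx
    exact ⟨neg_mem hx, (map_neg (splitMap k) x).trans (by rw [ihx, Prod.neg_mk, neg_zero]; rfl)⟩

theorem splitMap_unipotent_mul_simple (s : ℕ) {f : k[X]} (hf : Irreducible f)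
    (hf0 : f.eval 0 ≠ 0) :
    splitMap k ((unipotentCls k s : RepRing k) * (simpleCls f hf hf0 : RepRing k)) =
      (unipotentCls k s ⊗ₜ simpleCls f hf hf0, 0) := by
  obtain ⟨⟨g, hg⟩, hfg⟩ := exists_monic_associated hf
  have hg0 : g.eval 0 ≠ 0 := by
    obtain ⟨u, hu⟩ := hfg.symm
    exact fun h => hf0 (by rw [← hu, Polynomial.eval_mul, h, zero_mul])
  have h1 : simpleCls f hf hf0 = simpleCls g hg.2 hg0 :=
    Subtype.ext (cyclic_cls_congr hfg _ _)
  have h2 : (unipotentCls k s : RepRing k) * (simpleCls g hg.2 hg0 : RepRing k) =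
      (jordan (⟨g, hg⟩, s)).cls := cls_unipotent_mul_simple hg.2 hg0 s
  rw [h1, h2, splitMap_jordan hg hg0]

theorem splitMap_mul (a : unipotentSubring k) (b : simpleSubring k) :
    splitMap k ((a : RepRing k) * b) = (a ⊗ₜ b, 0) := by
  obtain ⟨a, ha⟩ := a
  have ha' : a ∈ unipotentSpan k := ha
  -- membership in the subgroup is carried along the induction, as the claim depends on it
  suffices h : ∃ ha : a ∈ unipotentSubring k, splitMap k (a * b) = (⟨a, ha⟩ ⊗ₜ b, 0) from h.2
  induction ha' using AddSubgroup.closure_induction with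
  | mem r hr =>
    obtain ⟨s, hs, rfl⟩ := hr
    obtain ⟨s, rfl⟩ := Nat.exists_eq_add_of_le' hs
    refine ⟨(unipotentCls k s).2, ?_⟩
    change splitMap k (unipotentCls k s * b) = (unipotentCls k s ⊗ₜ b, 0)
    obtain ⟨b, hb⟩ := b
    have hb' : b ∈ simpleSpan k := hb
    suffices h : ∃ hb : b ∈ simpleSubring k, splitMap k (unipotentCls k s * b) =
      (unipotentCls k s ⊗ₜ ⟨b, hb⟩, 0) from h.2
    clear ha
    induction hb' using AddSubgroup.closure_induction with
    | mem r hr =>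
      obtain ⟨f, hf, hf0, rfl⟩ := hr
      exact ⟨(simpleCls f hf hf0).2, splitMap_unipotent_mul_simple s hf hf0⟩
    | zero =>
      refine ⟨zero_mem _, ?_⟩
      rw [mul_zero, map_zero]
      exact Prod.ext (TensorProduct.tmul_zero _ _).symm rfl
    | add x y hx hy ihx ihy =>
      obtain ⟨hx, ihx⟩ := ihx hx
      obtain ⟨hy, ihy⟩ := ihy hy
      refine ⟨add_mem hx hy, ?_⟩
      rw [mul_add, map_add, ihx, ihy, Prod.mk_add_mk, add_zero, ← TensorProduct.tmul_add]
      rfl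
    | neg x hx ihx =>
      obtain ⟨hx, ihx⟩ := ihx hx
      refine ⟨neg_mem hx, ((congrArg (splitMap k) (mul_neg _ _)).trans
        (map_neg (splitMap k) _)).trans ?_⟩
      rw [ihx, Prod.neg_mk, neg_zero, ← TensorProduct.tmul_neg]
      rfl
  | zero =>
    refine ⟨zero_mem _, ?_⟩
    rw [zero_mul, map_zero]
    exact Prod.ext (TensorProduct.zero_tmul _ _).symm rfl
  | add x y hx hy ihx ihy =>
    obtain ⟨hx, ihx⟩ := ihx hx
    obtain ⟨hy, ihy⟩ := ihy hy
    refine ⟨add_mem hx hy, ?_⟩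
    rw [add_mul, map_add, ihx, ihy, Prod.mk_add_mk, add_zero, ← TensorProduct.add_tmul]
    rfl
  | neg x hx ihx =>
    obtain ⟨hx, ihx⟩ := ihx hx
    refine ⟨neg_mem hx, ((congrArg (splitMap k) (neg_mul _ _)).trans
      (map_neg (splitMap k) _)).trans ?_⟩
    rw [ihx, Prod.neg_mk, neg_zero, ← TensorProduct.neg_tmul]
    rfl

theorem splitMap_mulMap (t : unipotentSubring k ⊗[ℤ] simpleSubring k) :
    splitMap k (mulMap k t) = (t, 0) := by
  induction t with
  | zero => rw [map_zero, map_zero]; rfl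
  | add x y hx hy => rw [map_add, map_add, hx, hy, Prod.mk_add_mk, add_zero]
  | tmul a b => rw [mulMap_tmul, splitMap_mul]

theorem mulMap_add_splitMap (r : RepRing k) :
    mulMap k (splitMap k r).1 + ((splitMap k r).2 : RepRing k) = r := by
  let F : RepRing k →+ RepRing k :=
    (mulMap k).toAddMonoidHom.comp ((AddMonoidHom.fst _ _).comp (splitMap k).toAddMonoidHom) +
      (nilpotentIdeal k).subtype.toAddMonoidHom.comp
        ((AddMonoidHom.snd _ _).comp (splitMap k).toAddMonoidHom)
  have hF : F.toIntLinearMap = LinearMap.id := (jordanBasis k).ext fun j => by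
    change mulMap k (splitMap k (jordanBasis k j)).1
      + ((splitMap k (jordanBasis k j)).2 : RepRing k) = jordanBasis k j
    rw [jordanBasis_apply]
    obtain ⟨⟨f, hf⟩, s⟩ := j
    by_cases h : f = Polynomial.X
    · subst h
      rw [splitMap_jordan_X, map_zero, zero_add]
      rfl
    · have hf0 := eval_zero_ne_zero hf.2 hf.1 h
      rw [splitMap_jordan hf hf0, mulMap_tmul]
      exact (add_zero _).trans (cls_unipotent_mul_simple hf.2 hf0 s)
  exact LinearMap.congr_fun hF r

/-- The ring isomorphism `R' ⊗ R̄ ⊕ I ≅ R`. -/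
def dimSumEquiv (k : Type u) [Field k] [PerfectField k] :
    DimSum (tensorDim (unipotentSubring k) (simpleSubring k)) (nilpotentIdeal k) ≃+*
      RepRing k where
  toFun p := mulMap k p.1 + (p.2 : RepRing k)
  invFun r := DimSum.mk _ (splitMap k r).1 (splitMap k r).2
  left_inv p := by
    change splitMap k (mulMap k p.1 + (p.2 : RepRing k)) = (p.1, p.2)
    rw [map_add, splitMap_mulMap, splitMap_nilpotent, Prod.mk_add_mk, add_zero, zero_add]
  right_inv r := mulMap_add_splitMap r
  map_mul' p q := by
    have hp := mulMap_mul p.1 q.2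
    have hq := mulMap_mul q.1 p.2
    rw [DimSum.fst_mul, DimSum.snd_mul, map_mul, ← hp, ← hq]
    ring
  map_add' p q := by
    rw [DimSum.fst_add, DimSum.snd_add, map_add]
    ring

end PolyRep

end

theorem mainTheorem1 (k : Type u) [Field k] [PerfectField k] :
    -- `R` is freely generated, as an abelian group, by the isoclasses of indecomposables
    (∃ β : Module.Basis (PolyRep.IndecClass k) ℤ (PolyRep.RepRing k),
      ∀ c : PolyRep.IndecClass k, β c = c.1.cls) ∧
    -- `R'` and `R̄` are subrings of `R`, `I` is an ideal, and `φ` is a ring isomorphism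
    ∃ (R' Rbar : Subring (PolyRep.RepRing k)) (I : Ideal (PolyRep.RepRing k)),
      R'.toAddSubgroup = PolyRep.unipotentSpan k ∧
      Rbar.toAddSubgroup = PolyRep.simpleSpan k ∧
      I.toAddSubgroup = PolyRep.nilpotentSpan k ∧
      ∃ φ : PolyRep.DimSum (PolyRep.tensorDim R' Rbar) I ≃+* PolyRep.RepRing k,
        ∀ (a : R') (b : Rbar) (w : I),
          φ (PolyRep.DimSum.mk (PolyRep.tensorDim R' Rbar) (a ⊗ₜ[ℤ] b) w)
            = (a : PolyRep.RepRing k) * b + w := by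
  refine ⟨PolyRep.exists_basis_indecClass k, PolyRep.unipotentSubring k, PolyRep.simpleSubring k,
    PolyRep.nilpotentIdeal k, rfl, rfl, rfl, PolyRep.dimSumEquiv k, fun a b w => ?_⟩
  exact congrArg (· + (w : PolyRep.RepRing k)) (PolyRep.mulMap_tmul a b)
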